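/- Let $\mathcal A$ be the CAR algebra of spinless fermions over $\mathbb Z$: the $C^*$-algebra generated by $a_i, a_i^*$ $(i\in\mathbb Z)$ with $\{a_i^*,a_j\}=\delta_{ij}1$, $\{a_i,a_j\}=0$, and let $\mathcal A_\circ=\bigcup_{I}\mathcal A(I)$ be its local subalgebra, the union of the algebras $\mathcal A(I)$ generated by $a_i,a_i^*$, $i\in I$, over finite $I\subset\mathbb Z$. Let $\gamma$ be the automorphism of $\mathcal A$ with $\gamma(a_i)=-a_i$ and $[\cdot,\cdot]_\gamma$ the graded commutator for the associated even/odd grading. The Nicolai model has the formal supercharge $Q=\sum_{i\in\mathbb Z}a_{2i+1}a_{2i}^*a_{2i-1}$, which defines on $\mathcal A_\circ$ the superderivations $\delta(A)=[Q,A]_\gamma$ and $\delta^*(A)=[Q^*,A]_\gamma$ and the derivation $d=\delta^*\delta+\delta\delta^*$ (formally $d(A)=[H,A]$ with $H=QQ^*+Q^*Q$). A state $\varphi$ on $\mathcal A$ is supersymmetric if $\varphi(\delta(A))=0$ for all $A\in\mathcal A_\circ$. The time evolution of the model is the strongly continuous one-parameter group $(\alpha_t)_{t\in\mathbb R}$ of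 $*$-automorphisms of $\mathcal A$ whose generator is the norm closure of $i\,d$ on $\mathcal A_\circ$. For a configuration $g:\mathbb Z\to\{0,1\}$, the classical state $\psi_g$ is the state on $\mathcal A$ determined by the infinite product vector $\cdots\otimes|g(i-1)\rangle\otimes|g(i)\rangle\otimes|g(i+1)\rangle\otimes\cdots$; that is, on each $\mathcal A(I)$ it is the vector state of $\bigotimes_{i\in I}|g(i)\rangle$. **Theorem.** For every $g:\mathbb Z\to\{0,1\}$, the classical state $\psi_g$ is supersymmetric if and only if for no $i\in\mathbb Z$ the triple $(g(2i-1),g(2i),g(2i+1))$ equals $(0,1,0)$ or $(1,0,1)$. The time evolution $\alpha_t$ exists, and every such $\psi_g$ is a ground state for it (that is, $-i\,\psi_g(A^*D(A))\ge 0$ for every $A$ in the domain of the generator $D$ of $\alpha_t$) and is invariant under it: $\psi_g(\alpha_t(A))=\psi_g(A)$ for all $t\in\mathbb R$ and $A\in\mathcal A$. -/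

import Mathlib

open Filter Topology
open scoped ComplexOrder

noncomputable section

namespace Nicolai

/-! ### Fock space over the lattice `ℤ` and the fermion operators -/

/-- The fermion Fock space over `ℤ`, realised as `ℓ²` of its occupation number basis: a finite set
`S` of sites labels the vector in which exactly the sites of `S` are occupied. -/
abbrev Fock : Type := lp (fun _ : Finset ℤ => ℂ) 2

/-- Bounded operators on Fock space. -/
abbrev Op : Type := Fock →L[ℂ] Fock

/-- The occupation number basis vector `|S⟩ = a*_{i₁} ⋯ a*_{iₖ} |∅⟩`, where
`S = {i₁ < ⋯ < iₖ}`. -/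
def ket (S : Finset ℤ) : Fock := lp.single 2 S 1

/-- The function `T ↦ c T * f (σ T)` is square summable, and its norm is at most that of `f`. -/
theorem weightedShift_aux (σ : Equiv.Perm (Finset ℤ)) (c : Finset ℤ → ℂ)
    (hc : ∀ T, ‖c T‖ ≤ 1) (f : Fock) :
    ∃ h : Memℓp (fun T => c T * f (σ T)) 2, ‖(⟨_, h⟩ : Fock)‖ ≤ ‖f‖ := by
  have h2 : 0 < (2 : ENNReal).toReal := by norm_num
  have hs : Summable fun T => ‖f T‖ ^ (2 : ENNReal).toReal := (lp.memℓp f).summable h2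
  have hs' : Summable fun T => ‖f (σ T)‖ ^ (2 : ENNReal).toReal := (σ.summable_iff).2 hs
  have hle : ∀ T, ‖c T * f (σ T)‖ ^ (2 : ENNReal).toReal ≤ ‖f (σ T)‖ ^ (2 : ENNReal).toReal := by
    intro T
    refine Real.rpow_le_rpow (norm_nonneg _) ?_ h2.le
    rw [norm_mul]
    exact mul_le_of_le_one_left (norm_nonneg _) (hc T)
  have hs'' : Summable fun T => ‖c T * f (σ T)‖ ^ (2 : ENNReal).toReal :=
    Summable.of_nonneg_of_le (fun _ => Real.rpow_nonneg (norm_nonneg _) _) hle hs'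
  refine ⟨memℓp_gen hs'', lp.norm_le_of_tsum_le h2 (norm_nonneg _) ?_⟩
  rw [lp.norm_rpow_eq_tsum h2 f, ← σ.tsum_eq (fun T => ‖f T‖ ^ (2 : ENNReal).toReal)]
  exact hs''.tsum_le_tsum hle hs'

/-- The bounded operator `(W f)(T) = c T * f (σ T)` on Fock space, for a permutation `σ` of the
basis labels and weights `|c T| ≤ 1`. -/
def weightedShift (σ : Equiv.Perm (Finset ℤ)) (c : Finset ℤ → ℂ) (hc : ∀ T, ‖c T‖ ≤ 1) : Op :=
  LinearMap.mkContinuous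
    { toFun := fun f => ⟨fun T => c T * f (σ T), (weightedShift_aux σ c hc f).1⟩
      map_add' := fun f g => by ext T; exact mul_add _ _ _
      map_smul' := fun r f => by ext T; simp [mul_left_comm] }
    1 (fun f => by
      rw [one_mul]
      exact (weightedShift_aux σ c hc f).2)

@[simp] theorem weightedShift_apply (σ : Equiv.Perm (Finset ℤ)) (c : Finset ℤ → ℂ)
    (hc : ∀ T, ‖c T‖ ≤ 1) (f : Fock) (T : Finset ℤ) :
    weightedShift σ c hc f T = c T * f (σ T) := rfl

/-- Flipping the occupation of site `i`. -/
def flip (i : ℤ) : Equiv.Perm (Finset ℤ) :=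
  Function.Involutive.toPerm (fun T => symmDiff T {i})
    (fun T => symmDiff_symmDiff_cancel_right {i} T)

/-- The sign `(-1)^{#{j ∈ T : j < i}}` that a fermion operator at `i` picks up. -/
def jwSign (i : ℤ) (T : Finset ℤ) : ℂ := (-1) ^ (T.filter (· < i)).card

theorem norm_jwSign (i : ℤ) (T : Finset ℤ) : ‖jwSign i T‖ = 1 := by simp [jwSign]

/-- The annihilation operator `a_i`:
`a_i |S⟩ = (-1)^{#{j ∈ S : j < i}} |S \ {i}⟩` if `i ∈ S`, and `a_i |S⟩ = 0` otherwise.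
In coordinates, `(a_i f)(T) = (-1)^{#{j ∈ T : j < i}} f (T ∪ {i})` if `i ∉ T`, and `0` otherwise. -/
def annihilation (i : ℤ) : Op :=
  weightedShift (flip i) (fun T => if i ∈ T then 0 else jwSign i T)
    (fun T => by split_ifs <;> simp [norm_jwSign])

/-- The parity operator `(-1)^F`, where `F` is the total fermion number. -/
def parity : Op := weightedShift 1 (fun T => (-1) ^ T.card) (fun T => by simp)

/-! ### The CAR algebra -/

/-- The local algebra `𝒜(I)` generated by `a_i, a_i*`, `i ∈ I`. -/
def localAlgebra (I : Finset ℤ) : StarSubalgebra ℂ Op :=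
  StarAlgebra.adjoin ℂ (annihilation '' (I : Set ℤ))

/-- The CAR algebra `𝒜` over `ℤ`: the norm closure of the union of the local algebras (which is
directed, hence agrees with the star subalgebra it generates). -/
def carAlgebra : StarSubalgebra ℂ Op :=
  (⨆ I : Finset ℤ, localAlgebra I).topologicalClosure

/-- The CAR algebra as a type. -/
abbrev CAR : Type := carAlgebra

instance : IsClosed (carAlgebra : Set Op) := StarSubalgebra.isClosed_topologicalClosure _

theorem localAlgebra_mono {I J : Finset ℤ} (h : I ⊆ J) : localAlgebra I ≤ localAlgebra J :=
  StarAlgebra.adjoin_mono (Set.image_mono (by exact_mod_cast h))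

theorem mem_iSup_localAlgebra {A : Op} :
    A ∈ (⨆ I : Finset ℤ, localAlgebra I) ↔ ∃ I, A ∈ localAlgebra I := by
  have hdir : Directed (· ≤ ·) localAlgebra := fun I J =>
    ⟨I ∪ J, localAlgebra_mono Finset.subset_union_left,
      localAlgebra_mono Finset.subset_union_right⟩
  rw [← SetLike.mem_coe, StarSubalgebra.coe_iSup_of_directed hdir]
  simp

theorem mem_carAlgebra_of_mem_local {I : Finset ℤ} {A : Op} (h : A ∈ localAlgebra I) :
    A ∈ carAlgebra :=
  StarSubalgebra.le_topologicalClosure _ (mem_iSup_localAlgebra.2 ⟨I, h⟩)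

theorem annihilation_mem_local {I : Finset ℤ} {i : ℤ} (h : i ∈ I) :
    annihilation i ∈ localAlgebra I :=
  StarAlgebra.subset_adjoin _ _ ⟨i, h, rfl⟩

/-- The annihilation operator as an element of the CAR algebra. The creation operator is
`star (a i)`. -/
def a (i : ℤ) : CAR :=
  ⟨annihilation i, mem_carAlgebra_of_mem_local (annihilation_mem_local (Finset.mem_singleton_self i))⟩

/-- `A` belongs to the local algebra `𝒜_∘`, the union of the `𝒜(I)` over finite `I`. -/
def IsLocal (A : CAR) : Prop := ∃ I : Finset ℤ, (A : Op) ∈ localAlgebra I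

/-! ### Adjoints, products and the grading -/

theorem star_weightedShift {σ : Equiv.Perm (Finset ℤ)} {c d : Finset ℤ → ℂ}
    (hc : ∀ T, ‖c T‖ ≤ 1) (hd : ∀ T, ‖d T‖ ≤ 1)
    (hσ : ∀ T, σ (σ T) = T) (hcd : ∀ T, star (c (σ T)) = d T) :
    star (weightedShift σ c hc) = weightedShift σ d hd := by
  rw [ContinuousLinearMap.star_eq_adjoint, eq_comm, ContinuousLinearMap.eq_adjoint_iff]
  intro f g
  rw [lp.inner_eq_tsum, lp.inner_eq_tsum, ← σ.tsum_eq]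
  refine tsum_congr fun T => ?_
  have := hcd (σ T)
  rw [hσ] at this
  simp only [weightedShift_apply, hσ, RCLike.inner_apply, map_mul]
  rw [← this]
  simp only [RCLike.star_def, RCLike.conj_conj]
  ring

theorem parity_mul_parity : parity * parity = 1 := by
  ext f T
  simp [parity, ← mul_assoc, ← mul_pow]

theorem star_parity : star parity = parity :=
  star_weightedShift _ _ (fun _ => rfl) (fun T => by simp)

theorem mem_flip {i : ℤ} {T : Finset ℤ} {j : ℤ} :
    j ∈ flip i T ↔ (j ∈ T ∧ j ≠ i) ∨ (j = i ∧ j ∉ T) := by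
  simp [flip, Function.Involutive.toPerm, Finset.mem_symmDiff]

theorem flip_flip (i : ℤ) (T : Finset ℤ) : flip i (flip i T) = T := by
  ext j; simp only [mem_flip]; tauto

theorem flip_of_mem {i : ℤ} {T : Finset ℤ} (h : i ∈ T) : flip i T = T.erase i := by
  ext j; simp only [mem_flip, Finset.mem_erase]
  constructor
  · rintro (⟨h1, h2⟩ | ⟨rfl, h2⟩)
    · exact ⟨h2, h1⟩
    · exact absurd h h2
  · rintro ⟨h1, h2⟩; exact Or.inl ⟨h2, h1⟩

theorem flip_of_notMem {i : ℤ} {T : Finset ℤ} (h : i ∉ T) : flip i T = insert i T := by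
  ext j; simp only [mem_flip, Finset.mem_insert]
  constructor
  · rintro (⟨h1, h2⟩ | ⟨rfl, h2⟩)
    · exact Or.inr h1
    · exact Or.inl rfl
  · rintro (rfl | h1)
    · exact Or.inr ⟨rfl, h⟩
    · exact Or.inl ⟨h1, fun e => h (e ▸ h1)⟩

theorem neg_one_pow_card_flip (i : ℤ) (T : Finset ℤ) :
    (-1 : ℂ) ^ (flip i T).card = -(-1) ^ T.card := by
  by_cases h : i ∈ T
  · rw [flip_of_mem h, ← Finset.card_erase_add_one h, pow_succ]; ring
  · rw [flip_of_notMem h, Finset.card_insert_of_notMem h, pow_succ]; ring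

theorem jwSign_flip (i j : ℤ) (T : Finset ℤ) :
    jwSign i (flip j T) = if j < i then -jwSign i T else jwSign i T := by
  unfold jwSign
  split_ifs with h
  · have : (flip j T).filter (· < i) = flip j (T.filter (· < i)) := by
      ext k; simp only [mem_flip, Finset.mem_filter]
      constructor
      · rintro ⟨(⟨h1, h2⟩ | ⟨rfl, h2⟩), h3⟩
        · exact Or.inl ⟨⟨h1, h3⟩, h2⟩
        · exact Or.inr ⟨rfl, fun h4 => h2 h4.1⟩
      · rintro (⟨⟨h1, h3⟩, h2⟩ | ⟨rfl, h2⟩)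
        · exact ⟨Or.inl ⟨h1, h2⟩, h3⟩
        · exact ⟨Or.inr ⟨rfl, fun h4 => h2 ⟨h4, h⟩⟩, h⟩
    rw [this, neg_one_pow_card_flip]
  · have : (flip j T).filter (· < i) = T.filter (· < i) := by
      ext k; simp only [mem_flip, Finset.mem_filter]
      constructor
      · rintro ⟨(⟨h1, h2⟩ | ⟨rfl, h2⟩), h3⟩
        · exact ⟨h1, h3⟩
        · exact absurd h3 h
      · rintro ⟨h1, h3⟩
        exact ⟨Or.inl ⟨h1, fun e => h (e ▸ h3)⟩, h3⟩
    rw [this]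

theorem jwSign_mul_self (i : ℤ) (T : Finset ℤ) : jwSign i T * jwSign i T = 1 := by
  simp [jwSign, ← mul_pow]

theorem star_jwSign (i : ℤ) (T : Finset ℤ) : star (jwSign i T) = jwSign i T := by
  simp [jwSign]

theorem parity_conj_annihilation (i : ℤ) :
    parity * annihilation i * parity = -annihilation i := by
  ext f T
  have h : ((-1 : ℂ) ^ T.card) * (-1) ^ T.card = 1 := by simp [← mul_pow]
  simp only [parity, annihilation, mul_apply_eq_comp, weightedShift_apply,
    Equiv.Perm.coe_one, id_eq, neg_apply, lp.coeFn_neg, Pi.neg_apply,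
    neg_one_pow_card_flip]
  linear_combination (-(if i ∈ T then 0 else jwSign i T) * f (flip i T)) * h

/-- `a_j + a_j*`, a self-adjoint unitary. -/
def flipOp (j : ℤ) : Op :=
  weightedShift (flip j) (jwSign j) (fun T => (norm_jwSign j T).le)

theorem flipOp_mul_flipOp (j : ℤ) : flipOp j * flipOp j = 1 := by
  ext f T
  simp [flipOp, jwSign_flip, flip_flip, ← mul_assoc, jwSign_mul_self]

theorem star_flipOp (j : ℤ) : star (flipOp j) = flipOp j :=
  star_weightedShift _ _ (flip_flip j) (fun T => by simp [jwSign_flip, -RCLike.star_def, star_jwSign])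

theorem flip_comm (i j : ℤ) (T : Finset ℤ) : flip i (flip j T) = flip j (flip i T) := by
  ext k; simp only [mem_flip]; tauto

theorem flipOp_conj_annihilation {i j : ℤ} (h : i ≠ j) :
    flipOp j * annihilation i * flipOp j = -annihilation i := by
  ext f T
  have hi : i ∈ flip j T ↔ i ∈ T := by simp only [mem_flip]; tauto
  have hf : flip j (flip i (flip j T)) = flip i T := by rw [flip_comm i j, flip_flip]
  simp only [flipOp, annihilation, mul_apply_eq_comp, weightedShift_apply,
    neg_apply, lp.coeFn_neg, Pi.neg_apply, hi, hf]
  split_ifs with hT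
  · simp
  · rw [flip_comm, jwSign_flip j j, jwSign_flip j i, jwSign_flip i j]
    have := jwSign_mul_self j T
    rcases lt_or_gt_of_ne h with h' | h'
    · simp only [h', lt_irrefl, h'.not_gt, if_true, if_false]
      linear_combination (-jwSign i T * f (flip i T)) * this
    · simp only [h', lt_irrefl, h'.not_gt, if_true, if_false]
      linear_combination (-jwSign i T * f (flip i T)) * this

/-- Conjugation by a self-adjoint unitary `V` that changes the sign of every `a_i`, `i ∈ I`,
coincides with conjugation by the parity on `𝒜(I)`. -/
theorem conj_eq_parity_conj {I : Finset ℤ} {V : Op} (hV : V * V = 1) (hVs : star V = V)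
    (hVa : ∀ i ∈ I, V * annihilation i * V = -annihilation i) {A : Op}
    (hA : A ∈ localAlgebra I) : V * A * V = parity * A * parity := by
  induction hA using StarAlgebra.adjoin_induction with
  | mem x hx =>
    obtain ⟨i, hi, rfl⟩ := hx
    rw [hVa i hi, parity_conj_annihilation]
  | algebraMap r =>
    rw [← Algebra.commutes r V, ← Algebra.commutes r parity, mul_assoc, mul_assoc, hV,
      parity_mul_parity]
  | add x y _ _ hx hy => rw [mul_add, mul_add, add_mul, add_mul, hx, hy]
  | mul x y _ _ hx hy =>
    have e1 : V * (x * y) * V = (V * x * V) * (V * y * V) := by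
      have : (V * x * V) * (V * y * V) = V * x * (V * V) * y * V := by simp only [mul_assoc]
      rw [this, hV, mul_one]; simp only [mul_assoc]
    have e2 : parity * (x * y) * parity = (parity * x * parity) * (parity * y * parity) := by
      have : (parity * x * parity) * (parity * y * parity)
          = parity * x * (parity * parity) * y * parity := by simp only [mul_assoc]
      rw [this, parity_mul_parity, mul_one]; simp only [mul_assoc]
    rw [e1, e2, hx, hy]
  | star x _ hx =>
    have := congrArg star hx
    simpa only [star_mul, hVs, star_parity, mul_assoc] using this

theorem parity_conj_mem_local {I : Finset ℤ} {A : Op} (hA : A ∈ localAlgebra I) :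
    parity * A * parity ∈ localAlgebra I := by
  induction hA using StarAlgebra.adjoin_induction with
  | mem x hx =>
    obtain ⟨i, hi, rfl⟩ := hx
    rw [parity_conj_annihilation]
    exact neg_mem (annihilation_mem_local hi)
  | algebraMap r =>
    rw [← Algebra.commutes r parity, mul_assoc, parity_mul_parity, mul_one]
    exact algebraMap_mem _ r
  | add x y _ _ hx hy => rw [mul_add, add_mul]; exact add_mem hx hy
  | mul x y _ _ hx hy =>
    have e2 : parity * (x * y) * parity = (parity * x * parity) * (parity * y * parity) := by
      have : (parity * x * parity) * (parity * y * parity)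
          = parity * x * (parity * parity) * y * parity := by simp only [mul_assoc]
      rw [this, parity_mul_parity, mul_one]; simp only [mul_assoc]
    rw [e2]; exact mul_mem hx hy
  | star x _ hx =>
    have := star_mem hx
    simpa only [star_mul, star_parity, mul_assoc] using this

theorem parity_conj_mem {A : Op} (hA : A ∈ carAlgebra) : parity * A * parity ∈ carAlgebra := by
  have hc : Continuous fun A : Op => parity * A * parity := by fun_prop
  refine map_mem_closure (f := fun A : Op => parity * A * parity) hc hA fun B hB => ?_
  obtain ⟨I, hI⟩ := mem_iSup_localAlgebra.1 hB
  exact mem_iSup_localAlgebra.2 ⟨I, parity_conj_mem_local hI⟩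

/-- The grading automorphism `γ = Ad (-1)^F` of the CAR algebra; `γ(a_i) = -a_i`. -/
def grading (A : CAR) : CAR := ⟨parity * (A : Op) * parity, parity_conj_mem A.2⟩

theorem grading_a (i : ℤ) : grading (a i) = -a i :=
  Subtype.ext (parity_conj_annihilation i)

/-- `a_i*` in coordinates. -/
theorem star_annihilation (i : ℤ) :
    star (annihilation i) = weightedShift (flip i) (fun T => if i ∈ T then jwSign i T else 0)
      (fun T => by split_ifs <;> simp [norm_jwSign]) := by
  refine star_weightedShift _ _ (flip_flip i) fun T => ?_
  have hi : i ∈ flip i T ↔ i ∉ T := by simp only [mem_flip]; tauto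
  by_cases h : i ∈ T <;> simp [hi, h, jwSign_flip, -RCLike.star_def, star_jwSign]

/-- The canonical anticommutation relation `{a_i, a_j} = 0`. -/
theorem a_mul_a (i j : ℤ) : a i * a j + a j * a i = 0 := by
  refine Subtype.ext (?_ : annihilation i * annihilation j + annihilation j * annihilation i = 0)
  ext f T
  have hi : i ∈ flip j T ↔ (i ∈ T ∧ i ≠ j) ∨ (i = j ∧ i ∉ T) := mem_flip
  have hj : j ∈ flip i T ↔ (j ∈ T ∧ j ≠ i) ∨ (j = i ∧ j ∉ T) := mem_flip
  simp only [annihilation, mul_apply_eq_comp, weightedShift_apply, add_apply, lp.coeFn_add,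
    Pi.add_apply, jwSign_flip, flip_comm j i, zero_apply, lp.coeFn_zero, Pi.zero_apply]
  rcases lt_trichotomy i j with h | rfl | h
  · simp only [hi, hj, h, h.not_gt, h.ne, h.ne', if_true, if_false]
    by_cases h1 : i ∈ T <;> by_cases h2 : j ∈ T <;> simp [h1, h2, h.ne, h.ne'] <;> ring
  · by_cases h1 : i ∈ T <;> simp [hi, h1]
  · simp only [hi, hj, h, h.not_gt, h.ne, h.ne', if_true, if_false]
    by_cases h1 : i ∈ T <;> by_cases h2 : j ∈ T <;> simp [h1, h2, h.ne, h.ne'] <;> ring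

/-- The canonical anticommutation relation `{a_i*, a_j} = δ_{i,j} 1`. -/
theorem star_a_mul_a (i j : ℤ) :
    star (a i) * a j + a j * star (a i) = if i = j then 1 else 0 := by
  refine Subtype.ext ?_
  have e : ((if i = j then 1 else 0 : CAR) : Op) = if i = j then 1 else 0 := by
    split_ifs <;> rfl
  rw [e]
  change star (annihilation i) * annihilation j + annihilation j * star (annihilation i) = _
  rw [star_annihilation]
  ext f T
  have hi : i ∈ flip j T ↔ (i ∈ T ∧ i ≠ j) ∨ (i = j ∧ i ∉ T) := mem_flip
  have hj : j ∈ flip i T ↔ (j ∈ T ∧ j ≠ i) ∨ (j = i ∧ j ∉ T) := mem_flip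
  simp only [annihilation, mul_apply_eq_comp, weightedShift_apply, add_apply, lp.coeFn_add,
    Pi.add_apply, jwSign_flip, flip_comm j i]
  rcases lt_trichotomy i j with h | rfl | h
  · simp only [hi, hj, h, h.not_gt, h.ne, h.ne', if_true, if_false]
    by_cases h1 : i ∈ T <;> by_cases h2 : j ∈ T <;> simp [h1, h2, h.ne, h.ne'] <;> ring
  · by_cases h1 : i ∈ T <;> simp [hi, h1, flip_flip, ← mul_assoc, jwSign_mul_self]
  · simp only [hi, hj, h, h.not_gt, h.ne, h.ne', if_true, if_false]
    by_cases h1 : i ∈ T <;> by_cases h2 : j ∈ T <;> simp [h1, h2, h.ne, h.ne'] <;> ring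

/-- The even part of an element. -/
def evenPart (A : CAR) : CAR := (1 / 2 : ℂ) • (A + grading A)

/-- The odd part of an element. -/
def oddPart (A : CAR) : CAR := (1 / 2 : ℂ) • (A - grading A)

/-- The graded commutator `[A, B]_γ`: the anticommutator of two odd elements, the commutator of
two homogeneous elements one of which is even, extended bilinearly. -/
def gradedCommutator (A B : CAR) : CAR :=
  (evenPart A * B - B * evenPart A)
    + (oddPart A * evenPart B - evenPart B * oddPart A)
    + (oddPart A * oddPart B + oddPart B * oddPart A)

/-! ### The Nicolai model -/

/-- The local supercharge `q_{2i} = a_{2i+1} a*_{2i} a_{2i-1}` on `{2i-1, 2i, 2i+1}`. -/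
def localCharge (i : ℤ) : CAR := a (2 * i + 1) * star (a (2 * i)) * a (2 * i - 1)

/-- The superderivation `δ(A) = [Q, A]_γ`, `Q = ∑ i, q_{2i}`. For local `A` only finitely many
terms are nonzero. -/
def superDer (A : CAR) : CAR := ∑ᶠ i : ℤ, gradedCommutator (localCharge i) A

/-- The conjugate superderivation `δ*(A) = [Q*, A]_γ`. -/
def superDerStar (A : CAR) : CAR := ∑ᶠ i : ℤ, gradedCommutator (star (localCharge i)) A

/-- The derivation `d = δ* δ + δ δ*`, that is `d(A) = [H, A]` with `H = Q Q* + Q* Q`; it is used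
on local elements. -/
def hamDer (A : CAR) : CAR := superDerStar (superDer A) + superDer (superDerStar A)

/-- States of the CAR algebra: normalised positive linear functionals. -/
def IsState (φ : CAR →ₗ[ℂ] ℂ) : Prop := (∀ A : CAR, 0 ≤ φ (star A * A)) ∧ φ 1 = 1

/-- A supersymmetric state of the Nicolai model: `φ (δ A) = 0` for every local `A`. -/
def IsSupersymmetric (φ : CAR →ₗ[ℂ] ℂ) : Prop :=
  IsState φ ∧ ∀ A : CAR, IsLocal A → φ (superDer A) = 0

/-- The graph of the generator of `α`: `B` is the norm derivative of `α_t(A)` at `t = 0`. -/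
def generatorGraph (α : ℝ → CAR ≃⋆ₐ[ℂ] CAR) : Set (CAR × CAR) :=
  {p | HasDerivAt (fun t : ℝ => α t p.1) p.2 0}

/-- `α` is the time evolution of the Nicolai model: the strongly continuous one-parameter group of
`*`-automorphisms `α_t = exp (i t d)` whose generator is the closure of `i d` on the local
algebra. -/
structure IsTimeEvolution (α : ℝ → CAR ≃⋆ₐ[ℂ] CAR) : Prop where
  map_add : ∀ (s t : ℝ) (A : CAR), α (s + t) A = α s (α t A)
  continuous : ∀ A : CAR, Continuous fun t : ℝ => α t A
  generator : generatorGraph α =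
    closure {p : CAR × CAR | IsLocal p.1 ∧ p.2 = Complex.I • hamDer p.1}

/-- `φ` is a ground state for `α`: `-i φ(A* D(A)) ≥ 0` for every `A` in the domain of the
generator `D` of `α`. -/
def IsGroundState (α : ℝ → CAR ≃⋆ₐ[ℂ] CAR) (φ : CAR →ₗ[ℂ] ℂ) : Prop :=
  IsState φ ∧ ∀ A B : CAR, (A, B) ∈ generatorGraph α → 0 ≤ -Complex.I * φ (star A * B)

/-- A state is invariant under `α`. -/
def IsInvariant (α : ℝ → CAR ≃⋆ₐ[ℂ] CAR) (φ : CAR →ₗ[ℂ] ℂ) : Prop :=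
  ∀ (t : ℝ) (A : CAR), φ (α t A) = φ A

/-! ### Classical configurations and classical states -/

/-- A ground-state configuration: none of the blocks `{2i-1, 2i, 2i+1}` carries `0,1,0` or
`1,0,1`. -/
def IsGroundConfig (g : ℤ → Fin 2) : Prop :=
  ∀ i : ℤ, ¬ (g (2 * i - 1) = 0 ∧ g (2 * i) = 1 ∧ g (2 * i + 1) = 0) ∧
    ¬ (g (2 * i - 1) = 1 ∧ g (2 * i) = 0 ∧ g (2 * i + 1) = 1)

/-- The occupied sites in the finite region `Λ`. -/
def occupied (g : ℤ → Fin 2) (Λ : Finset ℤ) : Finset ℤ := Λ.filter fun i => g i = 1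

/-- The expectation of `A` in the product vector that agrees with `g` in `Λ` and is empty
outside `Λ`. -/
def expectation (g : ℤ → Fin 2) (Λ : Finset ℤ) (A : Op) : ℂ :=
  inner ℂ (ket (occupied g Λ)) (A (ket (occupied g Λ)))

theorem norm_ket (S : Finset ℤ) : ‖ket S‖ = 1 := by
  rw [ket, lp.norm_single (by norm_num)]; simp

theorem inner_ket (S : Finset ℤ) (f : Fock) : inner ℂ (ket S) f = f S := by
  rw [ket, lp.inner_single_left]; simp

theorem expectation_eq (g : ℤ → Fin 2) (Λ : Finset ℤ) (A : Op) :
    expectation g Λ A = A (ket (occupied g Λ)) (occupied g Λ) := inner_ket _ _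

theorem norm_expectation_le (g : ℤ → Fin 2) (Λ : Finset ℤ) (A : Op) :
    ‖expectation g Λ A‖ ≤ ‖A‖ := by
  refine (norm_inner_le_norm _ _).trans ?_
  have := A.le_opNorm (ket (occupied g Λ))
  simpa [norm_ket] using this

theorem parity_ket (S : Finset ℤ) : parity (ket S) = (-1 : ℂ) ^ S.card • ket S := by
  ext T
  by_cases h : T = S
  · subst h; simp [parity, ket]
  · simp [parity, ket, lp.single_apply, h]

theorem flipOp_ket (j : ℤ) (S : Finset ℤ) : flipOp j (ket S) = jwSign j S • ket (flip j S) := by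
  ext T
  by_cases h : T = flip j S
  · subst h; simp [flipOp, ket, flip_flip, jwSign_flip]
  · have h' : flip j T ≠ S := fun e => h (by rw [← e, flip_flip])
    simp [flipOp, ket, lp.single_apply, h, h']

/-- The diagonal matrix elements of an element of `𝒜(I)` do not see sites outside `I`. -/
theorem diag_flip {I : Finset ℤ} {A : Op} (hA : A ∈ localAlgebra I) {j : ℤ} (hj : j ∉ I)
    (S : Finset ℤ) : A (ket (flip j S)) (flip j S) = A (ket S) S := by
  have h := conj_eq_parity_conj (flipOp_mul_flipOp j) (star_flipOp j)
    (fun i hi => flipOp_conj_annihilation (fun e => hj (e ▸ hi))) hA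
  have h1 := congrArg (fun X : Op => (X (ket S) : Fock) S) h
  simp only [mul_apply_eq_comp, parity_ket, flipOp_ket, map_smul] at h1
  simp only [lp.coeFn_smul, Pi.smul_apply, smul_eq_mul, flipOp, parity, weightedShift_apply,
    Equiv.Perm.coe_one, id_eq, ← mul_assoc, jwSign_mul_self, ← mul_pow] at h1
  simpa using h1

theorem diag_insert {I : Finset ℤ} {A : Op} (hA : A ∈ localAlgebra I) {j : ℤ} (hj : j ∉ I)
    (g : ℤ → Fin 2) (Λ : Finset ℤ) : expectation g (insert j Λ) A = expectation g Λ A := by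
  rw [expectation_eq, expectation_eq]
  by_cases h : g j = 1 ∧ j ∉ Λ
  · have : occupied g (insert j Λ) = flip j (occupied g Λ) := by
      rw [flip_of_notMem (by simp [occupied, h.2]), occupied, Finset.filter_insert, if_pos h.1]
      rfl
    rw [this, diag_flip hA hj]
  · have : occupied g (insert j Λ) = occupied g Λ := by
      ext k
      simp only [occupied, Finset.mem_filter, Finset.mem_insert]
      constructor
      · rintro ⟨rfl | h1, h2⟩
        · exact ⟨by_contra fun h3 => h ⟨h2, h3⟩, h2⟩
        · exact ⟨h1, h2⟩
      · rintro ⟨h1, h2⟩; exact ⟨Or.inr h1, h2⟩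
    rw [this]

/-- On `𝒜(I)` the expectation stabilises as soon as the region contains `I`. -/
theorem expectation_of_subset {I : Finset ℤ} {A : Op} (hA : A ∈ localAlgebra I)
    (g : ℤ → Fin 2) {Λ : Finset ℤ} (h : I ⊆ Λ) : expectation g Λ A = expectation g I A := by
  have key : ∀ J : Finset ℤ, Disjoint J I → expectation g (J ∪ I) A = expectation g I A := by
    intro J
    induction J using Finset.induction_on with
    | empty => intro _; simp
    | insert j J _ ih =>
      intro hd
      rw [Finset.disjoint_insert_left] at hd
      rw [Finset.insert_union, diag_insert hA hd.1, ih hd.2]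
  have := key (Λ \ I) Finset.sdiff_disjoint
  rwa [Finset.sdiff_union_of_subset h] at this

theorem expectation_add (g : ℤ → Fin 2) (Λ : Finset ℤ) (A B : Op) :
    expectation g Λ (A + B) = expectation g Λ A + expectation g Λ B := by
  simp [expectation]

theorem expectation_smul (g : ℤ → Fin 2) (Λ : Finset ℤ) (r : ℂ) (A : Op) :
    expectation g Λ (r • A) = r * expectation g Λ A := by
  simp [expectation]

theorem expectation_sub (g : ℤ → Fin 2) (Λ : Finset ℤ) (A B : Op) :
    expectation g Λ (A - B) = expectation g Λ A - expectation g Λ B := by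
  simp [expectation]

/-- The expectations converge along the finite regions, for every element of the CAR algebra. -/
theorem exists_tendsto_expectation (g : ℤ → Fin 2) (A : CAR) :
    ∃ z, Tendsto (fun Λ => expectation g Λ (A : Op)) atTop (𝓝 z) := by
  refine cauchy_map_iff_exists_tendsto.1 (Metric.cauchy_iff.2 ⟨inferInstance, fun ε hε => ?_⟩)
  obtain ⟨B, hB, hAB⟩ := Metric.mem_closure_iff.1 A.2 (ε / 2) (by positivity)
  obtain ⟨I, hI⟩ := mem_iSup_localAlgebra.1 hB
  refine ⟨_, image_mem_map (mem_atTop I), ?_⟩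
  have key : ∀ Λ, I ⊆ Λ → dist (expectation g Λ (A : Op)) (expectation g I B) < ε / 2 := by
    intro Λ hΛ
    rw [← expectation_of_subset hI g hΛ, dist_eq_norm, ← expectation_sub]
    rw [dist_eq_norm] at hAB
    exact (norm_expectation_le _ _ _).trans_lt hAB
  rintro _ ⟨Λ, hΛ, rfl⟩ _ ⟨Λ', hΛ', rfl⟩
  exact (dist_triangle_right _ _ _).trans_lt (by linarith [key Λ hΛ, key Λ' hΛ'])

/-- The classical state `ψ_g` of the configuration `g`, i.e. the state determined by the infinite
product vector `⋯ ⊗ |g(i-1)⟩ ⊗ |g(i)⟩ ⊗ |g(i+1)⟩ ⊗ ⋯`: the limit, over finite regions `Λ`, of the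
expectations in the vectors that agree with `g` in `Λ`. -/
def classicalState (g : ℤ → Fin 2) : CAR →ₗ[ℂ] ℂ where
  toFun A := (exists_tendsto_expectation g A).choose
  map_add' A B := by
    refine tendsto_nhds_unique (exists_tendsto_expectation g (A + B)).choose_spec ?_
    refine ((exists_tendsto_expectation g A).choose_spec.add
      (exists_tendsto_expectation g B).choose_spec).congr fun Λ => ?_
    exact (expectation_add g Λ A B).symm
  map_smul' r A := by
    refine tendsto_nhds_unique (exists_tendsto_expectation g (r • A)).choose_spec ?_
    refine ((exists_tendsto_expectation g A).choose_spec.const_mul r).congr fun Λ => ?_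
    exact (expectation_smul g Λ r A).symm

theorem tendsto_classicalState (g : ℤ → Fin 2) (A : CAR) :
    Tendsto (fun Λ => expectation g Λ (A : Op)) atTop (𝓝 (classicalState g A)) :=
  (exists_tendsto_expectation g A).choose_spec

/-- On `𝒜(I)`, the classical state is the vector state of `⊗_{i ∈ I} |g(i)⟩`. -/
theorem classicalState_of_mem_local (g : ℤ → Fin 2) {I : Finset ℤ} {A : CAR}
    (hA : (A : Op) ∈ localAlgebra I) : classicalState g A = expectation g I A := by
  refine tendsto_nhds_unique (tendsto_classicalState g A) (tendsto_const_nhds.congr' ?_)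
  filter_upwards [eventually_ge_atTop I] with Λ hΛ
  exact (expectation_of_subset hA g hΛ).symm

theorem isState_classicalState (g : ℤ → Fin 2) : IsState (classicalState g) := by
  constructor
  · intro A
    refine ge_of_tendsto' (tendsto_classicalState g (star A * A)) fun Λ => ?_
    have : expectation g Λ ((star A * A : CAR) : Op)
        = inner ℂ ((A : Op) (ket (occupied g Λ))) ((A : Op) (ket (occupied g Λ))) := by
      simp [expectation, ContinuousLinearMap.star_eq_adjoint,
        ContinuousLinearMap.adjoint_inner_right]
    rw [this, inner_self_eq_norm_sq_to_K]
    rw [← RCLike.ofReal_pow]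
    exact Complex.zero_le_real.2 (sq_nonneg _)
  · refine tendsto_nhds_unique (tendsto_classicalState g 1) (tendsto_const_nhds.congr fun Λ => ?_)
    simp [expectation, norm_ket]

end Nicolai

end

/-! Everything reduces to finite boxes. A local charge is odd and graded-commutes with observables
supported off its triple. On a local `A` the superderivation is therefore `Q A - γ(A) Q`, with `Q`
the charge of any large enough box, and `d` is the commutator with `H = Q* Q + Q Q*` (`superDer_eq`,
`hamDer_eq_box`).

Supersymmetry. Let `v` be the product vector of `g` in a large box. If `g` avoids the two patterns,
every local charge and its adjoint kill `v`, so `⟨v, (Q A - γ(A) Q) v⟩ = 0`. Conversely, test with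
`A = q*` for a local charge `q`. Distinct local charges send `v` to orthogonal vectors or to zero,
so the expectation collapses to `‖q* v‖² + ‖q v‖²`; its vanishing excludes both patterns on that
triple.

Time evolution. The box Hamiltonians have norm linear in the size of the box, and a commutator
enlarges a support by a bounded amount. Hence `k`-fold commutators grow like an ascending factorial,
and the exponential series converges uniformly in the volume for small times (`norm_term_le`).
Isometry and the group law extend the limit to all observables and all times (`exists_limit`). Local
observables form a core: the generator `D` is dissipative, and `1 - D` has dense range on them,
since a functional `f` killing that range satisfies `f(α_t A) = e^t f(A)`, which boundedness forbids
unless `f = 0` (`dense_range_one_sub`).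

Ground states. For a ground configuration `H v = 0`, so `ψ(A* d(A)) = ⟨A v, H A v⟩ ≥ 0` and `ψ(d(A))
= 0` on local `A`. Both pass to the closure, that is, to the whole generator. The second makes
`ψ(α_t A)` constant in `t`. -/

noncomputable section

namespace InnerDynamics

/-! ### Dynamics of a single bounded Hamiltonian. -/

variable {𝒜 : Type*} [CStarAlgebra 𝒜]

/-- The inner derivation `A ↦ i [h, A]`. -/
def innerDer (h : selfAdjoint 𝒜) : 𝒜 →L[ℂ] 𝒜 :=
  Complex.I • (ContinuousLinearMap.mul ℂ 𝒜 (h : 𝒜) - (ContinuousLinearMap.mul ℂ 𝒜).flip (h : 𝒜))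

theorem innerDer_apply (h : selfAdjoint 𝒜) (A : 𝒜) :
    innerDer h A = Complex.I • ((h : 𝒜) * A - A * (h : 𝒜)) := rfl

theorem norm_innerDer_apply_le (h : selfAdjoint 𝒜) (A : 𝒜) :
    ‖innerDer h A‖ ≤ 2 * ‖(h : 𝒜)‖ * ‖A‖ := by
  rw [innerDer_apply, norm_smul, Complex.norm_I, one_mul]
  calc _ ≤ ‖(h : 𝒜) * A‖ + ‖A * (h : 𝒜)‖ := norm_sub_le _ _
    _ ≤ ‖(h : 𝒜)‖ * ‖A‖ + ‖A‖ * ‖(h : 𝒜)‖ := add_le_add (norm_mul_le _ _) (norm_mul_le _ _)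
    _ = _ := by ring

/-- The dynamics `A ↦ exp (i t h) A exp (-i t h)` of the Hamiltonian `h`. -/
def heisenberg (h : selfAdjoint 𝒜) (t : ℝ) : 𝒜 ≃⋆ₐ[ℂ] 𝒜 :=
  Unitary.conjStarAlgAut ℂ 𝒜 (selfAdjoint.expUnitary (t • h))

theorem heisenberg_add (h : selfAdjoint 𝒜) (s t : ℝ) (A : 𝒜) :
    heisenberg h (s + t) A = heisenberg h s (heisenberg h t A) := by
  have hc : Commute ((s • h : selfAdjoint 𝒜) : 𝒜) ((t • h : selfAdjoint 𝒜) : 𝒜) :=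
    ((Commute.refl (h : 𝒜)).smul_left s).smul_right t
  rw [heisenberg, add_smul, hc.expUnitary_add, map_mul]
  rfl

/-- Left multiplication by `i t h` and right multiplication by `-i t h` commute, so the exponential
of their sum factorises into conjugation by a unitary. -/
theorem heisenberg_eq_exp (h : selfAdjoint 𝒜) (t : ℝ) (A : 𝒜) :
    heisenberg h t A = NormedSpace.exp (t • innerDer h) A := by
  let _ : NormedAlgebra ℚ (𝒜 →L[ℂ] 𝒜) := NormedAlgebra.restrictScalars ℚ ℂ _
  let _ : NormedAlgebra ℚ 𝒜 := NormedAlgebra.restrictScalars ℚ ℂ _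
  let _ : NormedAlgebra ℚ 𝒜ᵐᵒᵖ := NormedAlgebra.restrictScalars ℚ ℂ _
  set x : 𝒜 := Complex.I • ((t • h : selfAdjoint 𝒜) : 𝒜) with hx
  have hsum : t • innerDer h
      = ContinuousLinearMap.mul ℂ 𝒜 x + (ContinuousLinearMap.mul ℂ 𝒜).flip (-x) := by
    ext B
    simp [innerDer, hx, sub_eq_add_neg, smul_comm t Complex.I]
  have hcomm : Commute (ContinuousLinearMap.mul ℂ 𝒜 x)
      ((ContinuousLinearMap.mul ℂ 𝒜).flip (-x)) := by
    ext B
    simp [mul_assoc]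
  have hl : NormedSpace.exp (ContinuousLinearMap.mul ℂ 𝒜 x)
      = ContinuousLinearMap.mul ℂ 𝒜 (NormedSpace.exp x) := by
    let f : 𝒜 →+* (𝒜 →L[ℂ] 𝒜) :=
      { toFun := fun y => ContinuousLinearMap.mul ℂ 𝒜 y
        map_one' := by ext; simp
        map_mul' := fun y z => by ext; simp [mul_assoc]
        map_zero' := by ext; simp
        map_add' := fun y z => by ext; simp }
    exact (NormedSpace.map_exp f (ContinuousLinearMap.mul ℂ 𝒜).continuous x).symm
  have hr : NormedSpace.exp ((ContinuousLinearMap.mul ℂ 𝒜).flip (-x))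
      = (ContinuousLinearMap.mul ℂ 𝒜).flip (NormedSpace.exp (-x)) := by
    -- Right multiplication reverses products, hence the opposite algebra.
    let f : 𝒜ᵐᵒᵖ →+* (𝒜 →L[ℂ] 𝒜) :=
      { toFun := fun y => (ContinuousLinearMap.mul ℂ 𝒜).flip y.unop
        map_one' := by ext; simp
        map_mul' := fun y z => by ext; simp [mul_assoc]
        map_zero' := by ext; simp
        map_add' := fun y z => by ext; simp }
    have := NormedSpace.map_exp f
      ((ContinuousLinearMap.mul ℂ 𝒜).flip.continuous.comp MulOpposite.continuous_unop)
      (MulOpposite.op (-x))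
    rw [NormedSpace.exp_op] at this
    exact this.symm
  rw [hsum, NormedSpace.exp_add_of_commute hcomm, hl, hr]
  have hstar : star (NormedSpace.exp x) = NormedSpace.exp (-x) := by
    rw [NormedSpace.star_exp]
    simp [hx]
  have hu : (selfAdjoint.expUnitary (t • h) : 𝒜) = NormedSpace.exp x := rfl
  rw [heisenberg, Unitary.conjStarAlgAut_apply, hu, hstar]
  simp [mul_assoc]

theorem hasSum_heisenberg (h : selfAdjoint 𝒜) (t : ℝ) (A : 𝒜) :
    HasSum (fun k : ℕ => ((k.factorial : ℝ)⁻¹ * t ^ k) • (innerDer h ^ k) A)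
      (heisenberg h t A) := by
  rw [heisenberg_eq_exp]
  have := (NormedSpace.exp_series_hasSum_exp' (𝕂 := ℝ) (t • innerDer h)).mapL
    ((ContinuousLinearMap.apply ℂ 𝒜 A).restrictScalars ℝ)
  have e : ∀ k : ℕ, ((k.factorial : ℝ)⁻¹ * t ^ k) • (innerDer h ^ k) A
      = ((k.factorial : ℝ)⁻¹ • (t • innerDer h) ^ k) A := fun k => by
    have hp : ((t • innerDer h) ^ k) A = t ^ k • (innerDer h ^ k) A := by
      induction k with
      | zero => simp
      | succ k ih =>
        rw [pow_succ', pow_succ' (innerDer h), mul_apply_eq_comp, ih,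
          smul_apply, ContinuousLinearMap.map_smul_of_tower, smul_smul,
          ← pow_succ']
        rfl
    rw [smul_apply, hp, smul_smul]
  simp_rw [e]
  exact this

theorem hasDerivAt_heisenberg (h : selfAdjoint 𝒜) (A : 𝒜) (t : ℝ) :
    HasDerivAt (fun s : ℝ => heisenberg h s A) (heisenberg h t (innerDer h A)) t := by
  have := ((ContinuousLinearMap.apply ℂ 𝒜 A).restrictScalars ℝ).hasFDerivAt.comp_hasDerivAt t
    (hasDerivAt_exp_smul_const (𝕂 := ℝ) (innerDer h) t)
  simp only [heisenberg_eq_exp]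
  exact this

theorem heisenberg_zero (h : selfAdjoint 𝒜) (A : 𝒜) : heisenberg h 0 A = A := by
  have : selfAdjoint.expUnitary (0 : selfAdjoint 𝒜) = 1 := by ext; simp
  rw [heisenberg, zero_smul, this, map_one]
  rfl

theorem norm_heisenberg_sub_le (h : selfAdjoint 𝒜) (A : 𝒜) (t : ℝ) :
    ‖heisenberg h t A - A‖ ≤ ‖innerDer h A‖ * |t| := by
  have := Convex.norm_image_sub_le_of_norm_hasDerivWithin_le (s := Set.univ) (x := (0 : ℝ)) (y := t)
    (fun s _ => (hasDerivAt_heisenberg h A s).hasDerivWithinAt)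
    (fun s _ => (StarAlgEquiv.norm_map (heisenberg h s) _).le) convex_univ trivial trivial
  simpa [heisenberg_zero] using this

/-- The mean value inequality, fed with the first-order bound for the derivative. The remainder
involves `h` only through a double commutator, so it survives the infinite volume limit. -/
theorem norm_heisenberg_sub_sub_le (h : selfAdjoint 𝒜) (A : 𝒜) (t : ℝ) :
    ‖heisenberg h t A - A - t • innerDer h A‖ ≤ ‖innerDer h (innerDer h A)‖ * t ^ 2 := by
  have hd : ∀ s : ℝ, HasDerivAt (fun s : ℝ => heisenberg h s A - s • innerDer h A)
      (heisenberg h s (innerDer h A) - innerDer h A) s := fun s => by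
    have := (hasDerivAt_heisenberg h A s).fun_sub ((hasDerivAt_id s).smul_const (innerDer h A))
    rwa [one_smul] at this
  have := Convex.norm_image_sub_le_of_norm_hasDerivWithin_le (s := Set.uIcc 0 t)
    (x := (0 : ℝ)) (y := t) (C := ‖innerDer h (innerDer h A)‖ * |t|)
    (fun s _ => (hd s).hasDerivWithinAt)
    (fun s hs => (norm_heisenberg_sub_le h _ s).trans
      (mul_le_mul_of_nonneg_left (by simpa using Set.abs_sub_left_of_mem_uIcc hs) (norm_nonneg _)))
    (convex_uIcc 0 t) Set.left_mem_uIcc Set.right_mem_uIcc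
  simp only [heisenberg_zero, zero_smul, sub_zero, Real.norm_eq_abs, mul_assoc, abs_mul_abs_self]
    at this
  rw [sub_right_comm, sq]
  exact this

/-! ### Generators of isometric one-parameter groups -/

/-- By the group law, moving the base point from `0` to `t` amounts to applying the bounded map `α
t`. In particular orbits stay in the domain of the generator. -/
theorem hasDerivAt_orbit {α : ℝ → 𝒜 ≃⋆ₐ[ℂ] 𝒜}
    (hadd : ∀ (s t : ℝ) (A : 𝒜), α (s + t) A = α s (α t A)) {A B : 𝒜}
    (h : HasDerivAt (fun t : ℝ => α t A) B 0) (t : ℝ) :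
    HasDerivAt (fun s : ℝ => α s A) (α t B) t := by
  have hl : HasDerivAt (fun s : ℝ => α t (α s A)) (α t B) 0 := by
    let L : 𝒜 →L[ℝ] 𝒜 := LinearMap.mkContinuous
      { toFun := α t
        map_add' := map_add _
        map_smul' := fun r x => by simpa using map_smul (α t) (r : ℂ) x } 1
      (fun x => by rw [one_mul]; exact (StarAlgEquiv.norm_map (α t) x).le)
    exact L.hasFDerivAt.comp_hasDerivAt 0 h
  simp_rw [← hadd] at hl
  have hl' : HasDerivAt (fun s : ℝ => α (t + s) A) (α t B) (-t + t) := by simpa using hl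
  have := HasDerivAt.comp_const_add (-t) t hl'
  simpa using this

/-- Along a convergent sequence in the graph the orbit derivatives `α t (u n).2` converge uniformly
in `t`, because each `α t` is an isometry; so the limit may be differentiated. -/
theorem isClosed_generator {α : ℝ → 𝒜 ≃⋆ₐ[ℂ] 𝒜}
    (hadd : ∀ (s t : ℝ) (A : 𝒜), α (s + t) A = α s (α t A)) :
    IsClosed {p : 𝒜 × 𝒜 | HasDerivAt (fun t : ℝ => α t p.1) p.2 0} := by
  refine IsSeqClosed.isClosed fun u p hu hp => ?_
  have h0 : ∀ A, α 0 A = A := fun A => by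
    have := hadd 0 0 A
    rw [add_zero] at this
    exact ((α 0).injective this).symm
  have hp1 := (continuous_fst.tendsto p).comp hp
  have hp2 := (continuous_snd.tendsto p).comp hp
  have := hasDerivAt_of_tendstoUniformly (f := fun n t => α t (u n).1) (g := fun t => α t p.1)
    (f' := fun n t => α t (u n).2) (g' := fun t => α t p.2) (l := atTop) ?_
    (.of_forall fun n t => hasDerivAt_orbit hadd (hu n) t)
    (fun t => ((StarAlgEquiv.isometry (α t)).continuous.tendsto _).comp hp1) 0
  · simpa [h0] using this
  · rw [Metric.tendstoUniformly_iff]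
    intro ε hε
    filter_upwards [Metric.tendsto_nhds.1 hp2 ε hε] with n hn t
    rw [(StarAlgEquiv.isometry (α t)).dist_eq, dist_comm]
    exact hn

/-- The generator of an isometric group is dissipative. -/
theorem norm_le_norm_sub_generator {α : ℝ → 𝒜 ≃⋆ₐ[ℂ] 𝒜}
    (hadd : ∀ (s t : ℝ) (A : 𝒜), α (s + t) A = α s (α t A)) {A B : 𝒜}
    (h : HasDerivAt (fun t : ℝ => α t A) B 0) : ‖A‖ ≤ ‖A - B‖ := by
  have h0 : α 0 A = A := by
    have := hadd 0 0 A
    rw [add_zero] at this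
    exact ((α 0).injective this).symm
  refine le_of_forall_pos_le_add fun ε hε => ?_
  have hlittle := (hasDerivAt_iff_isLittleO_nhds_zero.1 h).def hε
  simp only [zero_add, h0] at hlittle
  obtain ⟨r, hr, hball⟩ := Metric.eventually_nhds_iff.1 hlittle
  -- Inside the ball of validity, and at most `1` so that `1 - s` is a nonnegative weight.
  set s : ℝ := min (r / 2) 1 with hs
  have hs0 : 0 < s := lt_min (by positivity) one_pos
  have hs1 : s ≤ 1 := min_le_right _ _
  have hsr : s < r := (min_le_left _ _).trans_lt (by linarith)
  have key := hball (y := -s) (by simpa [abs_of_pos hs0] using hsr)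
  rw [norm_neg, Real.norm_of_nonneg hs0.le] at key
  -- Backwards in time `α (-s) A` is `A - s B` up to `ε s`, and `A - s B` is a convex combination of
  -- `A` and `A - B`.
  have e : α (-s) A = (α (-s) A - A - (-s) • B) + ((1 - s) • A + s • (A - B)) := by module
  have h1 : ‖A‖ ≤ ε * s + ((1 - s) * ‖A‖ + s * ‖A - B‖) := by
    calc ‖A‖ = ‖α (-s) A‖ := (StarAlgEquiv.norm_map (α (-s)) A).symm
      _ ≤ ‖α (-s) A - A - (-s) • B‖ + ‖(1 - s) • A + s • (A - B)‖ := by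
          conv_lhs => rw [e]
          exact norm_add_le _ _
      _ ≤ _ := by
          refine add_le_add key ((norm_add_le _ _).trans ?_)
          rw [norm_smul, norm_smul, Real.norm_of_nonneg hs0.le,
            Real.norm_of_nonneg (by linarith : 0 ≤ 1 - s)]
  have : s * ‖A‖ ≤ s * (‖A - B‖ + ε) := by linarith
  exact le_of_mul_le_mul_left this hs0

/-- A part `S` of the generator such that `1 - S` has dense range is a core. -/
theorem generator_subset_closure {α : ℝ → 𝒜 ≃⋆ₐ[ℂ] 𝒜}
    (hadd : ∀ (s t : ℝ) (A : 𝒜), α (s + t) A = α s (α t A)) {S : Set (𝒜 × 𝒜)}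
    (hS : S ⊆ {p : 𝒜 × 𝒜 | HasDerivAt (fun t : ℝ => α t p.1) p.2 0})
    (hdense : Dense ((fun p : 𝒜 × 𝒜 => p.1 - p.2) '' S)) :
    {p : 𝒜 × 𝒜 | HasDerivAt (fun t : ℝ => α t p.1) p.2 0} ⊆ closure S := by
  rintro ⟨A, B⟩ hAB
  rw [Metric.mem_closure_iff]
  intro ε hε
  obtain ⟨_, hd, ⟨⟨A', B'⟩, hp, rfl⟩⟩ := Metric.dense_iff.1 hdense (A - B) (ε / 2) (by positivity)
  rw [Metric.mem_ball, dist_eq_norm] at hd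
  -- Dissipativity, applied to the difference of the two pairs, recovers closeness of first
  -- components from closeness of the values of `1 - D`.
  have hdis : ‖A' - A‖ ≤ ‖A' - A - (B' - B)‖ := by
    refine norm_le_norm_sub_generator hadd ?_
    simp_rw [map_sub]
    exact (hS hp).fun_sub hAB
  have e1 : A' - A - (B' - B) = A' - B' - (A - B) := by abel
  rw [e1] at hdis
  refine ⟨(A', B'), hp, ?_⟩
  rw [Prod.dist_eq, max_lt_iff, dist_comm, dist_eq_norm, dist_comm, dist_eq_norm]
  refine ⟨by linarith, ?_⟩
  have e2 : B' - B = (A' - A) - (A' - B' - (A - B)) := by abel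
  change ‖B' - B‖ < ε
  rw [e2]
  exact (norm_sub_le _ _).trans_lt (by linarith)

/-- Hahn–Banach: a nonzero class modulo the closure is detected by a functional on the quotient,
which pulls back to one killing `p`. -/
theorem dense_of_forall_dual {E : Type*} [NormedAddCommGroup E] [NormedSpace ℂ E]
    (p : Submodule ℂ E) (h : ∀ f : StrongDual ℂ E, (∀ x ∈ p, f x = 0) → f = 0) :
    Dense (p : Set E) := by
  rw [Submodule.dense_iff_topologicalClosure_eq_top, Submodule.eq_top_iff']
  intro x
  by_contra hx
  let q := p.topologicalClosure
  have hq : IsClosed (q : Set E) := p.isClosed_topologicalClosure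
  have hne : (Submodule.Quotient.mk x : E ⧸ q) ≠ 0 := fun e =>
    hx ((Submodule.Quotient.mk_eq_zero q).1 e)
  obtain ⟨f, hf⟩ := SeparatingDual.exists_ne_zero (R := ℂ) hne
  have := h (f.comp q.mkQL) fun y hy => by
    have : (Submodule.Quotient.mk y : E ⧸ q) = 0 :=
      (Submodule.Quotient.mk_eq_zero q).2 (p.le_topologicalClosure hy)
    simp [this]
  exact hf (by simpa using congrArg (fun g : StrongDual ℂ E => g x) this)

/-! ### The infinite volume limit -/

theorem tendsto_heisenberg_add {H : ℕ → selfAdjoint 𝒜} {s t : ℝ} {A B D : 𝒜}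
    (hB : Tendsto (fun m => heisenberg (H m) t A) atTop (𝓝 B))
    (hD : Tendsto (fun m => heisenberg (H m) s B) atTop (𝓝 D)) :
    Tendsto (fun m => heisenberg (H m) (s + t) A) atTop (𝓝 D) := by
  have : Tendsto (fun m => heisenberg (H m) (s + t) A - heisenberg (H m) s B) atTop (𝓝 0) := by
    rw [tendsto_zero_iff_norm_tendsto_zero]
    refine (tendsto_iff_norm_sub_tendsto_zero.1 hB).congr fun m => ?_
    rw [heisenberg_add, ← map_sub, StarAlgEquiv.norm_map]
  simpa using this.add hD

/-- A net of local Hamiltonians of finite range on an increasing family of spaces of local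
observables: on `F n` the commutator with `H m` does not depend on `m ≥ n` and has range in
`F (n + 1)`, and `H n` grows at most linearly. -/
structure IsFiniteRange (F : ℕ → Submodule ℂ 𝒜) (H : ℕ → selfAdjoint 𝒜) (C : ℝ) : Prop where
  mono : Monotone F
  dense : ∀ (A : 𝒜) (ε : ℝ), 0 < ε → ∃ n, ∃ B ∈ F n, ‖A - B‖ < ε
  innerDer_eq : ∀ {n m : ℕ}, n ≤ m → ∀ A ∈ F n, innerDer (H m) A = innerDer (H n) A
  innerDer_mem : ∀ {n : ℕ}, ∀ A ∈ F n, innerDer (H n) A ∈ F (n + 1)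
  pos : 0 < C
  norm_le : ∀ n : ℕ, ‖(H n : 𝒜)‖ ≤ C * (n + 1)

namespace IsFiniteRange

variable {F : ℕ → Submodule ℂ 𝒜} {H : ℕ → selfAdjoint 𝒜} {C : ℝ}

theorem pow_mem (hF : IsFiniteRange F H C) {n k m : ℕ} (h : n + k ≤ m) {A : 𝒜} (hA : A ∈ F n) :
    (innerDer (H m) ^ k) A ∈ F (n + k) := by
  induction k with
  | zero => simpa using hA
  | succ k ih =>
    rw [pow_succ', mul_apply_eq_comp, hF.innerDer_eq (by omega) _ (ih (by omega))]
    exact hF.innerDer_mem _ (ih (by omega))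

/-- Every intermediate commutator lies in a space where the Hamiltonian may be exchanged for a
larger one. The terms of the exponential series are thus eventually constant in the volume. -/
theorem pow_eq (hF : IsFiniteRange F H C) {n k m : ℕ} (h : n + k ≤ m) {A : 𝒜} (hA : A ∈ F n) :
    (innerDer (H m) ^ k) A = (innerDer (H (n + k)) ^ k) A := by
  have key : ∀ j m m' : ℕ, n + j ≤ m → n + j ≤ m' →
      (innerDer (H m) ^ j) A = (innerDer (H m') ^ j) A := by
    intro j
    induction j with
    | zero => simp
    | succ j ih =>
      intro m m' hm hm'
      rw [pow_succ', pow_succ' (innerDer (H m')), mul_apply_eq_comp, mul_apply_eq_comp,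
        hF.innerDer_eq (by omega) _ (hF.pow_mem (by omega) hA),
        hF.innerDer_eq (n := n + j) (m := m') (by omega) _ (hF.pow_mem (by omega) hA),
        ih m m' (by omega) (by omega)]
  exact key k _ _ h le_rfl

/-- The next commutator acts on an element of `F (n + k)`, where `H m` can be traded for `H (n + k)`
if `m` is larger. Each step thus costs a factor at most `2 * C * (n + k + 1)`, whatever `m` is. -/
theorem norm_pow_le (hF : IsFiniteRange F H C) {n : ℕ} (k m : ℕ) {A : 𝒜} (hA : A ∈ F n) :
    ‖(innerDer (H m) ^ k) A‖ ≤ (2 * C) ^ k * (n + 1).ascFactorial k * ‖A‖ := by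
  have hC := hF.pos
  induction k with
  | zero => simp
  | succ k ih =>
    have step : ‖(innerDer (H m) ^ (k + 1)) A‖
        ≤ 2 * (C * (n + k + 1)) * ‖(innerDer (H m) ^ k) A‖ := by
      rw [pow_succ', mul_apply_eq_comp]
      rcases le_total (n + k) m with h | h
      · rw [hF.innerDer_eq h _ (hF.pow_mem h hA)]
        refine (norm_innerDer_apply_le _ _).trans ?_
        have := hF.norm_le (n + k)
        push_cast at this
        gcongr
      · refine (norm_innerDer_apply_le _ _).trans ?_
        have := hF.norm_le m
        have h' : (m : ℝ) ≤ n + k := by exact_mod_cast h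
        have : ‖(H m : 𝒜)‖ ≤ C * (n + k + 1) := this.trans (by gcongr)
        gcongr
    refine step.trans ((mul_le_mul_of_nonneg_left ih (by positivity)).trans_eq ?_)
    rw [Nat.ascFactorial_succ]
    push_cast
    ring

/-- Dividing the ascending factorial by `k!` leaves a binomial coefficient, at most `2 ^ (n + k)`.
The terms are then geometric with ratio `4 * C * |t|`, and the radius `1 / (8 * C)` makes this at
most `1 / 2`. -/
theorem norm_term_le (hF : IsFiniteRange F H C) {n : ℕ} (k m : ℕ) {A : 𝒜} (hA : A ∈ F n) {t : ℝ} (ht : |t| ≤ 1 / (8 * C)) :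
    ‖((k.factorial : ℝ)⁻¹ * t ^ k) • (innerDer (H m) ^ k) A‖ ≤ 2 ^ n * ‖A‖ * (1 / 2) ^ k := by
  have hC := hF.pos
  have h1 : (((n + k).choose k : ℕ) : ℝ) ≤ 2 ^ (n + k) := by
    exact_mod_cast Nat.choose_le_two_pow (n + k) k
  have h2 : (k.factorial : ℝ) ≠ 0 := by exact_mod_cast k.factorial_ne_zero
  have h3 : 4 * C * |t| ≤ 1 / 2 := by
    rw [le_div_iff₀ (by positivity)] at ht
    linarith
  rw [norm_smul, norm_mul, norm_inv, norm_pow, Real.norm_eq_abs, Real.norm_eq_abs, Nat.abs_cast]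
  calc _ ≤ (k.factorial : ℝ)⁻¹ * |t| ^ k * ((2 * C) ^ k * (n + 1).ascFactorial k * ‖A‖) := by
        gcongr
        exact hF.norm_pow_le k m hA
    _ = |t| ^ k * ((2 * C) ^ k * (((n + k).choose k : ℕ) : ℝ) * ‖A‖) := by
        rw [Nat.ascFactorial_eq_factorial_mul_choose]
        push_cast
        field_simp
    _ ≤ |t| ^ k * ((2 * C) ^ k * 2 ^ (n + k) * ‖A‖) := by gcongr
    _ = 2 ^ n * ‖A‖ * (4 * C * |t|) ^ k := by
        rw [show 4 * C * |t| = |t| * (2 * C) * 2 by ring, mul_pow, mul_pow, pow_add]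
        ring
    _ ≤ _ := by gcongr

theorem summable_bound (n : ℕ) (A : 𝒜) :
    Summable fun k : ℕ => 2 ^ n * ‖A‖ * (1 / 2 : ℝ) ^ k :=
  summable_geometric_two.mul_left _

theorem tendsto_local (hF : IsFiniteRange F H C) {n : ℕ} {A : 𝒜} (hA : A ∈ F n) {t : ℝ} (ht : |t| ≤ 1 / (8 * C)) :
    Tendsto (fun m => heisenberg (H m) t A) atTop
      (𝓝 (∑' k : ℕ, ((k.factorial : ℝ)⁻¹ * t ^ k) • (innerDer (H (n + k)) ^ k) A)) := by
  simp_rw [← fun m => (hasSum_heisenberg (H m) t A).tsum_eq]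
  refine tendsto_tsum_of_dominated_convergence (summable_bound n A) (fun k => ?_)
    (.of_forall fun m k => hF.norm_term_le k m hA ht)
  refine tendsto_const_nhds.congr' ?_
  filter_upwards [eventually_ge_atTop (n + k)] with m hm
  rw [hF.pow_eq hm hA]

theorem exists_tendsto (hF : IsFiniteRange F H C) (t : ℝ) (A : 𝒜) :
    ∃ B, Tendsto (fun m => heisenberg (H m) t A) atTop (𝓝 B) := by
  have hC := hF.pos
  have small : ∀ t : ℝ, |t| ≤ 1 / (8 * C) → ∀ A : 𝒜,
      ∃ B, Tendsto (fun m => heisenberg (H m) t A) atTop (𝓝 B) := by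
    intro t ht A
    refine cauchySeq_tendsto_of_complete (Metric.cauchySeq_iff'.2 fun ε hε => ?_)
    -- Isometry makes the approximation error uniform in the volume, so convergence extends from
    -- local observables to all of them.
    obtain ⟨n, A', hA', hAA'⟩ := hF.dense A (ε / 3) (by positivity)
    obtain ⟨N, hN⟩ := Metric.cauchySeq_iff'.1 (hF.tendsto_local hA' ht).cauchySeq (ε / 3)
      (by positivity)
    refine ⟨N, fun m hm => ?_⟩
    have h1 : ∀ m, dist (heisenberg (H m) t A) (heisenberg (H m) t A') < ε / 3 := fun m => by
      rw [(StarAlgEquiv.isometry (heisenberg (H m) t)).dist_eq, dist_eq_norm]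
      exact hAA'
    have h2 := dist_triangle4_right (heisenberg (H m) t A) (heisenberg (H N) t A)
      (heisenberg (H m) t A') (heisenberg (H N) t A')
    linarith [hN m hm, h1 m, h1 N]
  have add : ∀ s t : ℝ, (∀ A : 𝒜, ∃ B, Tendsto (fun m => heisenberg (H m) s A) atTop (𝓝 B)) →
      (∀ A : 𝒜, ∃ B, Tendsto (fun m => heisenberg (H m) t A) atTop (𝓝 B)) →
      ∀ A : 𝒜, ∃ B, Tendsto (fun m => heisenberg (H m) (s + t) A) atTop (𝓝 B) := by
    intro s t hs ht A
    obtain ⟨B, hB⟩ := ht A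
    obtain ⟨D, hD⟩ := hs B
    exact ⟨D, tendsto_heisenberg_add hB hD⟩
  -- Splits `t` into `N + 1` equal steps within the radius of convergence.
  obtain ⟨N, hN⟩ := exists_nat_gt (|t| * (8 * C))
  have hN0 : (0 : ℝ) < N + 1 := by positivity
  have hmul : ∀ j : ℕ, ∀ A : 𝒜,
      ∃ B, Tendsto (fun m => heisenberg (H m) (j * (t / (N + 1))) A) atTop (𝓝 B) := by
    intro j
    induction j with
    | zero => exact small _ (by simp; positivity)
    | succ j ih =>
      have := add _ _ ih (small (t / (N + 1)) (by
        rw [abs_div, abs_of_pos hN0, div_le_div_iff₀ hN0 (by positivity)]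
        linarith))
      intro A
      have e : ((j + 1 : ℕ) : ℝ) * (t / (N + 1)) = j * (t / (N + 1)) + t / (N + 1) := by
        push_cast
        ring
      rw [e]
      exact this A
  have := hmul (N + 1) A
  rwa [Nat.cast_succ, mul_div_cancel₀ _ hN0.ne'] at this

/-- Algebraic identities pass to strong limits; invertibility comes from the limiting group law with
`-t`. -/
theorem exists_limit (hF : IsFiniteRange F H C) : ∃ α : ℝ → 𝒜 ≃⋆ₐ[ℂ] 𝒜,
    ∀ t A, Tendsto (fun m => heisenberg (H m) t A) atTop (𝓝 (α t A)) := by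
  choose β hβ using hF.exists_tendsto
  have hβ0 : ∀ A, β 0 A = A := fun A => tendsto_nhds_unique (hβ 0 A) (by simp [heisenberg_zero])
  have hinv : ∀ t A, β (-t) (β t A) = A := fun t A => by
    refine tendsto_nhds_unique (tendsto_heisenberg_add (hβ t A) (hβ (-t) _)) ?_
    simp [heisenberg_zero]
  refine ⟨fun t =>
    { toFun := β t
      invFun := β (-t)
      left_inv := hinv t
      right_inv := fun A => by simpa using hinv (-t) A
      map_mul' := fun A B => tendsto_nhds_unique (hβ t _) (by
        simpa using (hβ t A).mul (hβ t B))
      map_add' := fun A B => tendsto_nhds_unique (hβ t _) (by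
        simpa using (hβ t A).add (hβ t B))
      map_star' := fun A => tendsto_nhds_unique (hβ t _) (by
        simpa [map_star] using (hβ t A).star)
      map_smul' := fun r A => tendsto_nhds_unique (hβ t _) (by
        simpa using (hβ t A).const_smul r) }, hβ⟩

/-! ### The limiting group and a core for its generator. -/

variable {α : ℝ → 𝒜 ≃⋆ₐ[ℂ] 𝒜}

theorem limit_add (hα : ∀ t A, Tendsto (fun m => heisenberg (H m) t A) atTop (𝓝 (α t A)))
    (s t : ℝ) (A : 𝒜) : α (s + t) A = α s (α t A) :=
  tendsto_nhds_unique (hα _ _) (tendsto_heisenberg_add (hα t A) (hα s _))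

/-- From volume `n + 1` on, the first and second commutators no longer change, so the quadratic
remainder bound has a fixed constant and holds in the limit. -/
theorem hasDerivAt_limit (hF : IsFiniteRange F H C)
    (hα : ∀ t A, Tendsto (fun m => heisenberg (H m) t A) atTop (𝓝 (α t A)))
    {n : ℕ} {A : 𝒜} (hA : A ∈ F n) :
    HasDerivAt (fun t : ℝ => α t A) (innerDer (H n) A) 0 := by
  have h0 : α 0 A = A := tendsto_nhds_unique (hα 0 A) (by simp [heisenberg_zero])
  set M := ‖innerDer (H (n + 1)) (innerDer (H n) A)‖
  have bound : ∀ t : ℝ, ‖α t A - A - t • innerDer (H n) A‖ ≤ M * t ^ 2 := fun t => by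
    refine le_of_tendsto (((hα t A).sub_const A).sub_const (t • innerDer (H n) A)).norm ?_
    filter_upwards [eventually_ge_atTop (n + 1)] with m hm
    have := norm_heisenberg_sub_sub_le (H m) A t
    rwa [hF.innerDer_eq (by omega) A hA, hF.innerDer_eq hm _ (hF.innerDer_mem A hA)] at this
  rw [hasDerivAt_iff_isLittleO_nhds_zero]
  simp only [zero_add, h0]
  refine (Asymptotics.IsBigO.of_bound M (.of_forall fun t => ?_)).trans_isLittleO
    (Asymptotics.isLittleO_pow_id (n := 2) (by norm_num))
  simpa using bound t

/-- Such an `f` takes the value `f A` on every iterated commutator, so the series for `α t A`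
becomes the scalar exponential series. -/
theorem dual_limit (hF : IsFiniteRange F H C)
    (hα : ∀ t A, Tendsto (fun m => heisenberg (H m) t A) atTop (𝓝 (α t A)))
    {f : StrongDual ℂ 𝒜} (hf : ∀ n, ∀ A ∈ F n, f (innerDer (H n) A) = f A)
    {t : ℝ} (ht : |t| ≤ 1 / (8 * C)) (A : 𝒜) : f (α t A) = (Real.exp t : ℂ) * f A := by
  have local_case : ∀ n, ∀ A ∈ F n, f (α t A) = (Real.exp t : ℂ) * f A := by
    intro n A hA
    have hpow : ∀ k : ℕ, f ((innerDer (H (n + k)) ^ k) A) = f A := fun k => by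
      induction k with
      | zero => simp
      | succ k ih =>
        rw [pow_succ', mul_apply_eq_comp,
          hF.innerDer_eq (n := n + k) (by omega) _ (hF.pow_mem (by omega) hA),
          hf _ _ (hF.pow_mem (by omega) hA), hF.pow_eq (by omega) hA, ih]
    rw [tendsto_nhds_unique (hα t A) (hF.tendsto_local hA ht), f.map_tsum
      (Summable.of_norm_bounded (summable_bound n A) fun k => hF.norm_term_le k _ hA ht)]
    have hexp : HasSum (fun k : ℕ => t ^ k / k.factorial) (Real.exp t) := by
      rw [Real.exp_eq_exp_ℝ]
      exact NormedSpace.expSeries_div_hasSum_exp t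
    have := (Complex.hasSum_ofReal.2 hexp).mul_right (f A)
    rw [← this.tsum_eq]
    refine tsum_congr fun k => ?_
    rw [← Complex.coe_smul, map_smul, hpow, smul_eq_mul]
    push_cast
    ring
  have hclosed : IsClosed {A : 𝒜 | f (α t A) = (Real.exp t : ℂ) * f A} :=
    isClosed_eq (f.continuous.comp (StarAlgEquiv.isometry (α t)).continuous)
      (f.continuous.const_mul _)
  refine hclosed.closure_subset (Metric.mem_closure_iff.2 fun ε hε => ?_)
  obtain ⟨n, B, hB, hAB⟩ := hF.dense A ε hε
  exact ⟨B, local_case n B hB, by rwa [dist_eq_norm]⟩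

/-- A functional vanishing on this subspace would grow by a factor `exp t > 1` at each application
of the isometry `α t`, against its boundedness. -/
theorem dense_range_one_sub (hF : IsFiniteRange F H C)
    (hα : ∀ t A, Tendsto (fun m => heisenberg (H m) t A) atTop (𝓝 (α t A))) :
    Dense {B : 𝒜 | ∃ n, ∃ A ∈ F n, B = A - innerDer (H n) A} := by
  let p : Submodule ℂ 𝒜 :=
    { carrier := {B : 𝒜 | ∃ n, ∃ A ∈ F n, B = A - innerDer (H n) A}
      zero_mem' := ⟨0, 0, zero_mem _, by simp⟩
      add_mem' := by
        rintro _ _ ⟨n, A, hA, rfl⟩ ⟨m, B, hB, rfl⟩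
        refine ⟨max n m, A + B, add_mem (hF.mono (le_max_left _ _) hA)
          (hF.mono (le_max_right _ _) hB), ?_⟩
        rw [map_add, hF.innerDer_eq (le_max_left _ _) A hA, hF.innerDer_eq (le_max_right _ _) B hB]
        abel
      smul_mem' := by
        rintro c _ ⟨n, A, hA, rfl⟩
        exact ⟨n, c • A, Submodule.smul_mem _ c hA, by rw [map_smul, smul_sub]⟩ }
  refine dense_of_forall_dual p fun f hf => ?_
  have hf' : ∀ n, ∀ A ∈ F n, f (innerDer (H n) A) = f A := fun n A hA => by
    have := hf _ ⟨n, A, hA, rfl⟩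
    rw [map_sub, sub_eq_zero] at this
    exact this.symm
  have hC := hF.pos
  set t : ℝ := 1 / (8 * C) with ht
  have ht0 : 0 < t := by positivity
  have hdual := hF.dual_limit hα hf' (t := t) (by rw [abs_of_pos ht0])
  ext A
  have growth : ∀ k : ℕ, Real.exp t ^ k * ‖f A‖ ≤ ‖f‖ * ‖A‖ := by
    have : ∀ k : ℕ, ∀ A : 𝒜, Real.exp t ^ k * ‖f A‖ ≤ ‖f‖ * ‖A‖ := by
      intro k
      induction k with
      | zero =>
        intro A
        simpa using f.le_opNorm A
      | succ k ih =>
        intro A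
        have h1 := ih (α t A)
        rw [hdual, norm_mul, StarAlgEquiv.norm_map, Complex.norm_real,
          Real.norm_of_nonneg (Real.exp_pos t).le] at h1
        rwa [pow_succ, mul_assoc]
    exact fun k => this k A
  by_contra hne
  have hpos : 0 < ‖f A‖ := norm_pos_iff.2 hne
  obtain ⟨k, hk⟩ := pow_unbounded_of_one_lt (‖f‖ * ‖A‖ / ‖f A‖) (Real.one_lt_exp_iff.2 ht0)
  rw [div_lt_iff₀ hpos] at hk
  exact (growth k).not_gt hk

theorem continuous_limit (hF : IsFiniteRange F H C)
    (hα : ∀ t A, Tendsto (fun m => heisenberg (H m) t A) atTop (𝓝 (α t A))) (A : 𝒜) :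
    Continuous fun t : ℝ => α t A := by
  rw [Metric.continuous_iff']
  intro t ε hε
  obtain ⟨n, B, hB, hAB⟩ := hF.dense A (ε / 3) (by positivity)
  have hcont := (hasDerivAt_orbit (limit_add hα) (hF.hasDerivAt_limit hα hB) t).continuousAt
  filter_upwards [Metric.tendsto_nhds.1 hcont (ε / 3) (by positivity)] with s hs
  have h1 : ∀ s : ℝ, dist (α s A) (α s B) < ε / 3 := fun s => by
    rw [(StarAlgEquiv.isometry (α s)).dist_eq, dist_eq_norm]
    exact hAB
  have h2 := dist_triangle4_right (α s A) (α t A) (α s B) (α t B)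
  linarith [h1 s, h1 t]

/-- Local Hamiltonians of finite range generate a strongly continuous one-parameter group of
automorphisms, for whose generator the local observables are a core. -/
theorem exists_dynamics (hF : IsFiniteRange F H C) : ∃ α : ℝ → 𝒜 ≃⋆ₐ[ℂ] 𝒜,
    (∀ (s t : ℝ) (A : 𝒜), α (s + t) A = α s (α t A)) ∧
    (∀ A : 𝒜, Continuous fun t : ℝ => α t A) ∧
    {p : 𝒜 × 𝒜 | HasDerivAt (fun t : ℝ => α t p.1) p.2 0}
      = closure {p : 𝒜 × 𝒜 | ∃ n, p.1 ∈ F n ∧ p.2 = innerDer (H n) p.1} := by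
  obtain ⟨α, hα⟩ := hF.exists_limit
  have hsub : {p : 𝒜 × 𝒜 | ∃ n, p.1 ∈ F n ∧ p.2 = innerDer (H n) p.1}
      ⊆ {p : 𝒜 × 𝒜 | HasDerivAt (fun t : ℝ => α t p.1) p.2 0} := by
    rintro ⟨A, _⟩ ⟨n, hA, hB : _ = innerDer (H n) A⟩
    subst hB
    exact hF.hasDerivAt_limit hα hA
  refine ⟨α, limit_add hα, hF.continuous_limit hα, subset_antisymm ?_ ?_⟩
  · refine generator_subset_closure (limit_add hα) hsub ((hF.dense_range_one_sub hα).mono ?_)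
    rintro _ ⟨n, A, hA, rfl⟩
    exact ⟨(A, innerDer (H n) A), ⟨n, hA, rfl⟩, rfl⟩
  · exact closure_minimal hsub (isClosed_generator (limit_add hα))

end IsFiniteRange

end InnerDynamics

namespace Nicolai

/-! ### The grading automorphism -/

theorem coe_grading (A : CAR) : (grading A : Op) = parity * (A : Op) * parity := rfl

theorem grading_mul (A B : CAR) : grading (A * B) = grading A * grading B := by
  refine Subtype.ext ?_
  change parity * ((A : Op) * B) * parity = (parity * (A : Op) * parity) * (parity * B * parity)
  have : (parity * (A : Op) * parity) * (parity * B * parity)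
      = parity * (A : Op) * (parity * parity) * B * parity := by simp only [mul_assoc]
  rw [this, parity_mul_parity, mul_one]
  simp only [mul_assoc]

theorem grading_star (A : CAR) : grading (star A) = star (grading A) := by
  refine Subtype.ext ?_
  change parity * star (A : Op) * parity = star (parity * (A : Op) * parity)
  simp only [star_mul, star_parity, mul_assoc]

theorem grading_add (A B : CAR) : grading (A + B) = grading A + grading B :=
  Subtype.ext (by simp [coe_grading, mul_add, add_mul])

theorem grading_sub (A B : CAR) : grading (A - B) = grading A - grading B :=
  Subtype.ext (by simp [coe_grading, mul_sub, sub_mul])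

theorem grading_zero : grading 0 = 0 :=
  Subtype.ext (by simp [coe_grading])

theorem grading_sum {ι : Type*} (s : Finset ι) (f : ι → CAR) :
    grading (∑ i ∈ s, f i) = ∑ i ∈ s, grading (f i) :=
  map_sum (⟨⟨grading, grading_zero⟩, grading_add⟩ : CAR →+ CAR) f s

theorem grading_grading (A : CAR) : grading (grading A) = A := by
  refine Subtype.ext ?_
  change parity * (parity * (A : Op) * parity) * parity = A
  have : parity * (parity * (A : Op) * parity) * parity
      = (parity * parity) * (A : Op) * (parity * parity) := by simp only [mul_assoc]
  rw [this, parity_mul_parity, one_mul, mul_one]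

theorem gradedCommutator_of_odd {q : CAR} (hq : grading q = -q) (A : CAR) :
    gradedCommutator q A = q * A - grading A * q := by
  have he : evenPart q = 0 := by rw [evenPart, hq, add_neg_cancel, smul_zero]
  have ho : oddPart q = q := by
    rw [oddPart, hq, sub_neg_eq_add, ← two_smul ℂ q, smul_smul]
    norm_num
  have h1 : evenPart A + oddPart A = A := by
    rw [evenPart, oddPart]
    module
  have h2 : evenPart A - oddPart A = grading A := by
    rw [evenPart, oddPart]
    module
  rw [gradedCommutator, he, ho]
  -- Occurrence seven is the bare `A` in `q * A` on the right-hand side.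
  nth_rewrite 7 [← h1]
  rw [← h2]
  noncomm_ring

/-! ### Locality of the fermion operators -/

/-- Taking adjoints exchanges the relations for `a_i` and `a_i*`, so the induction over generated
elements must carry both. -/
theorem annihilation_mul_of_mem_local {I : Finset ℤ} {i : ℤ} (hi : i ∉ I) {A : Op}
    (hA : A ∈ localAlgebra I) :
    annihilation i * A = parity * A * parity * annihilation i ∧
      star (annihilation i) * A = parity * A * parity * star (annihilation i) := by
  have hpa : parity * annihilation i = -annihilation i * parity := by
    rw [← parity_conj_annihilation i, mul_assoc _ parity parity, parity_mul_parity, mul_one]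
  have hps : parity * star (annihilation i) = -star (annihilation i) * parity := by
    have := congrArg star hpa
    simp only [star_mul, star_neg, star_parity] at this
    rw [neg_mul, this]
    simp
  induction hA using StarAlgebra.adjoin_induction with
  | mem x hx =>
    obtain ⟨j, hj, rfl⟩ := hx
    have hne : i ≠ j := fun e => hi (e ▸ hj)
    rw [parity_conj_annihilation, neg_mul, neg_mul]
    refine ⟨eq_neg_of_add_eq_zero_left (congrArg Subtype.val (a_mul_a i j)), ?_⟩
    have := congrArg Subtype.val (star_a_mul_a i j)
    rw [if_neg hne] at this
    exact eq_neg_of_add_eq_zero_left this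
  | algebraMap r =>
    rw [← Algebra.commutes r parity, mul_assoc _ parity parity, parity_mul_parity, mul_one]
    exact ⟨(Algebra.commutes r _).symm, (Algebra.commutes r _).symm⟩
  | add x y _ _ hx hy => simp only [mul_add, add_mul, hx.1, hx.2, hy.1, hy.2, and_self]
  | mul x y _ _ hx hy =>
    have e : parity * (x * y) * parity = (parity * x * parity) * (parity * y * parity) := by
      have : (parity * x * parity) * (parity * y * parity)
          = parity * x * (parity * parity) * y * parity := by simp only [mul_assoc]
      rw [this, parity_mul_parity, mul_one]
      simp only [mul_assoc]
    rw [e]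
    exact ⟨by rw [← mul_assoc, hx.1, mul_assoc, hy.1, ← mul_assoc],
      by rw [← mul_assoc, hx.2, mul_assoc, hy.2, ← mul_assoc]⟩
  | star x _ hx =>
    have flip_star : ∀ b : Op, parity * b = -b * parity → parity * star b = -star b * parity →
        b * x = parity * x * parity * b → star b * star x = parity * star x * parity * star b := by
      intro b hb hb' hbx
      have h1 := congrArg star hbx
      simp only [star_mul, star_parity] at h1
      symm
      calc parity * star x * parity * star b = parity * star x * (parity * star b) :=
            mul_assoc _ _ _
        _ = -(parity * (star x * star b) * parity) := by
            rw [hb']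
            simp only [neg_mul, mul_neg, mul_assoc]
        _ = -((parity * star b) * parity * star x * (parity * parity)) := by
            rw [h1]
            simp only [mul_assoc]
        _ = star b * (parity * parity) * star x * (parity * parity) := by
            rw [hb']
            simp only [neg_mul, neg_neg, mul_assoc]
        _ = star b * star x := by rw [parity_mul_parity, mul_one, mul_one]
    exact ⟨by simpa using flip_star _ hps (by simpa using hpa) hx.2, flip_star _ hpa hps hx.1⟩

theorem a_mul_of_mem_local {I : Finset ℤ} {i : ℤ} (hi : i ∉ I) {A : CAR}
    (hA : (A : Op) ∈ localAlgebra I) : a i * A = grading A * a i :=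
  Subtype.ext (annihilation_mul_of_mem_local hi hA).1

theorem star_a_mul_of_mem_local {I : Finset ℤ} {i : ℤ} (hi : i ∉ I) {A : CAR}
    (hA : (A : Op) ∈ localAlgebra I) : star (a i) * A = grading A * star (a i) :=
  Subtype.ext (annihilation_mul_of_mem_local hi hA).2

/-! ### Local charges -/

theorem grading_localCharge (i : ℤ) : grading (localCharge i) = -localCharge i := by
  rw [localCharge, grading_mul, grading_mul, grading_star, grading_a, grading_a, grading_a]
  simp

theorem grading_star_localCharge (i : ℤ) :
    grading (star (localCharge i)) = -star (localCharge i) := by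
  rw [grading_star, grading_localCharge, star_neg]

/-- The sites on which `localCharge i` acts. -/
def triple (i : ℤ) : Finset ℤ := {2 * i - 1, 2 * i, 2 * i + 1}

theorem localCharge_mem (i : ℤ) : (localCharge i : Op) ∈ localAlgebra (triple i) :=
  mul_mem (mul_mem (annihilation_mem_local (by simp [triple]))
    (star_mem (annihilation_mem_local (by simp [triple]))))
    (annihilation_mem_local (by simp [triple]))

/-- Three fermion operators pass `A`, each contributing one grading, and `γ³ = γ`. -/
theorem localCharge_mul_of_disjoint {I : Finset ℤ} {i : ℤ} (hi : Disjoint (triple i) I) {A : CAR}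
    (hA : (A : Op) ∈ localAlgebra I) : localCharge i * A = grading A * localCharge i := by
  simp only [triple, Finset.disjoint_insert_left, Finset.disjoint_singleton_left] at hi
  have hγ : ((grading A : CAR) : Op) ∈ localAlgebra I := parity_conj_mem_local hA
  rw [localCharge, mul_assoc, a_mul_of_mem_local hi.1 hA, ← mul_assoc,
    mul_assoc _ _ (grading A), star_a_mul_of_mem_local hi.2.1 hγ, grading_grading, ← mul_assoc,
    a_mul_of_mem_local hi.2.2 hA]
  simp only [mul_assoc]

theorem star_localCharge_mul_of_disjoint {I : Finset ℤ} {i : ℤ} (hi : Disjoint (triple i) I)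
    {A : CAR} (hA : (A : Op) ∈ localAlgebra I) :
    star (localCharge i) * A = grading A * star (localCharge i) := by
  have h := congrArg star (localCharge_mul_of_disjoint hi
    (show ((star (grading A) : CAR) : Op) ∈ localAlgebra I from
      star_mem (parity_conj_mem_local hA)))
  rw [star_mul, star_mul, star_star, grading_star, grading_grading, star_star] at h
  exact h.symm

/-! ### Charges of finite regions -/

/-- The charge `∑ q_{2i}` of a finite set of triples. -/
def charge (J : Finset ℤ) : CAR := ∑ i ∈ J, localCharge i

theorem grading_charge (J : Finset ℤ) : grading (charge J) = -charge J := by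
  simp only [charge, grading_sum, grading_localCharge, Finset.sum_neg_distrib]

theorem grading_star_charge (J : Finset ℤ) : grading (star (charge J)) = -star (charge J) := by
  rw [grading_star, grading_charge, star_neg]

theorem charge_mem {J I : Finset ℤ} (h : ∀ i ∈ J, triple i ⊆ I) :
    (charge J : Op) ∈ localAlgebra I := by
  have : (charge J : Op) = ∑ i ∈ J, (localCharge i : Op) :=
    map_sum carAlgebra.subtype localCharge J
  rw [this]
  exact sum_mem fun i hi => localAlgebra_mono (h i hi) (localCharge_mem i)

/-- Charges whose triple misses the support contribute nothing, so the formal `Q` becomes any finite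
charge containing the remaining triples. -/
theorem superDer_eq {I J : Finset ℤ} (hJ : ∀ i ∉ J, Disjoint (triple i) I) {A : CAR}
    (hA : (A : Op) ∈ localAlgebra I) : superDer A = charge J * A - grading A * charge J := by
  rw [superDer, finsum_eq_sum_of_support_subset (s := J)]
  · simp only [gradedCommutator_of_odd (grading_localCharge _), charge, Finset.sum_mul,
      Finset.mul_sum, Finset.sum_sub_distrib]
  · intro i hi
    by_contra hiJ
    refine hi ?_
    beta_reduce
    rw [gradedCommutator_of_odd (grading_localCharge i),
      localCharge_mul_of_disjoint (hJ i (by simpa using hiJ)) hA, sub_self]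

theorem superDerStar_eq {I J : Finset ℤ} (hJ : ∀ i ∉ J, Disjoint (triple i) I) {A : CAR}
    (hA : (A : Op) ∈ localAlgebra I) :
    superDerStar A = star (charge J) * A - grading A * star (charge J) := by
  rw [superDerStar, finsum_eq_sum_of_support_subset (s := J)]
  · simp only [gradedCommutator_of_odd (grading_star_localCharge _), charge, star_sum,
      Finset.sum_mul, Finset.mul_sum, Finset.sum_sub_distrib]
  · intro i hi
    by_contra hiJ
    refine hi ?_
    beta_reduce
    rw [gradedCommutator_of_odd (grading_star_localCharge i),
      star_localCharge_mul_of_disjoint (hJ i (by simpa using hiJ)) hA, sub_self]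

/-- The interval of sites covered by the triples `-n, …, n`. -/
def box (n : ℕ) : Finset ℤ := Finset.Icc (-(2 * n + 1)) (2 * n + 1)

/-- The charge of the triples in `box n`. -/
def boxCharge (n : ℕ) : CAR := charge (Finset.Icc (-n : ℤ) n)

/-- The Hamiltonian `Q* Q + Q Q*` of the charge `Q` of `box n`. -/
def boxHam (n : ℕ) : CAR := star (boxCharge n) * boxCharge n + boxCharge n * star (boxCharge n)

theorem box_mono {n m : ℕ} (h : n ≤ m) : box n ⊆ box m :=
  Finset.Icc_subset_Icc (by omega) (by omega)

theorem exists_subset_box (I : Finset ℤ) : ∃ n, I ⊆ box n := by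
  -- The sum of the absolute values dominates each of them.
  refine ⟨∑ i ∈ I, i.natAbs, fun i hi => ?_⟩
  have := Finset.single_le_sum (f := Int.natAbs) (fun _ _ => Nat.zero_le _) hi
  rw [box, Finset.mem_Icc]
  omega

theorem isLocal_iff {A : CAR} : IsLocal A ↔ ∃ n, (A : Op) ∈ localAlgebra (box n) := by
  refine ⟨fun ⟨I, hI⟩ => ?_, fun ⟨n, hn⟩ => ⟨_, hn⟩⟩
  obtain ⟨n, hn⟩ := exists_subset_box I
  exact ⟨n, localAlgebra_mono hn hI⟩

theorem triple_subset_box {i : ℤ} {n : ℕ} (h : i ∈ Finset.Icc (-n : ℤ) n) : triple i ⊆ box n := by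
  rw [Finset.mem_Icc] at h
  intro k hk
  simp only [triple, Finset.mem_insert, Finset.mem_singleton] at hk
  rw [box, Finset.mem_Icc]
  omega

/-- The margin of one is needed: the triples `±(n + 1)` still share the sites `±(2n + 1)` with `box
n`. -/
theorem disjoint_triple_box {i : ℤ} {n m : ℕ} (hnm : n + 1 ≤ m)
    (h : i ∉ Finset.Icc (-m : ℤ) m) : Disjoint (triple i) (box n) := by
  rw [Finset.mem_Icc] at h
  rw [Finset.disjoint_left]
  intro k hk hk'
  simp only [triple, Finset.mem_insert, Finset.mem_singleton] at hk
  rw [box, Finset.mem_Icc] at hk'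
  omega

theorem boxCharge_mem (n : ℕ) : (boxCharge n : Op) ∈ localAlgebra (box n) :=
  charge_mem fun _ hi => triple_subset_box hi

theorem grading_boxCharge (n : ℕ) : grading (boxCharge n) = -boxCharge n := grading_charge _

theorem grading_star_boxCharge (n : ℕ) : grading (star (boxCharge n)) = -star (boxCharge n) :=
  grading_star_charge _

theorem superDer_eq_box {n m : ℕ} (h : n + 1 ≤ m) {A : CAR}
    (hA : (A : Op) ∈ localAlgebra (box n)) :
    superDer A = boxCharge m * A - grading A * boxCharge m :=
  superDer_eq (fun _ => disjoint_triple_box h) hA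

theorem superDerStar_eq_box {n m : ℕ} (h : n + 1 ≤ m) {A : CAR}
    (hA : (A : Op) ∈ localAlgebra (box n)) :
    superDerStar A = star (boxCharge m) * A - grading A * star (boxCharge m) :=
  superDerStar_eq (fun _ => disjoint_triple_box h) hA

theorem superDer_mem {n : ℕ} {A : CAR} (hA : (A : Op) ∈ localAlgebra (box n)) :
    (superDer A : Op) ∈ localAlgebra (box (n + 1)) := by
  rw [superDer_eq_box le_rfl hA]
  have hA' := localAlgebra_mono (box_mono n.le_succ) hA
  exact sub_mem (mul_mem (boxCharge_mem _) hA') (mul_mem (parity_conj_mem_local hA')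
    (boxCharge_mem _))

theorem superDerStar_mem {n : ℕ} {A : CAR} (hA : (A : Op) ∈ localAlgebra (box n)) :
    (superDerStar A : Op) ∈ localAlgebra (box (n + 1)) := by
  rw [superDerStar_eq_box le_rfl hA]
  have hA' := localAlgebra_mono (box_mono n.le_succ) hA
  exact sub_mem (mul_mem (star_mem (boxCharge_mem _)) hA') (mul_mem (parity_conj_mem_local hA')
    (star_mem (boxCharge_mem _)))

theorem hamDer_mem {n : ℕ} {A : CAR} (hA : (A : Op) ∈ localAlgebra (box n)) :
    (hamDer A : Op) ∈ localAlgebra (box (n + 2)) :=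
  add_mem (superDerStar_mem (superDer_mem hA)) (superDer_mem (superDerStar_mem hA))

/-- On local observables the derivation is the commutator with the Hamiltonian of any sufficiently
large box. -/
theorem hamDer_eq_box {n m : ℕ} (h : n + 2 ≤ m) {A : CAR}
    (hA : (A : Op) ∈ localAlgebra (box n)) : hamDer A = boxHam m * A - A * boxHam m := by
  rw [hamDer, superDerStar_eq_box (m := m) (by omega) (superDer_mem hA),
    superDer_eq_box (m := m) (by omega) (superDerStar_mem hA),
    superDer_eq_box (m := m) (by omega) hA, superDerStar_eq_box (m := m) (by omega) hA, boxHam]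
  -- The mixed terms `Q* γ(A) Q` and `Q γ(A) Q*` occur with both signs and cancel.
  simp only [grading_sub, grading_mul, grading_grading, grading_boxCharge, grading_star_boxCharge]
  noncomm_ring

/-! ### Norm bounds -/

theorem norm_weightedShift_le (σ : Equiv.Perm (Finset ℤ)) (c : Finset ℤ → ℂ)
    (hc : ∀ T, ‖c T‖ ≤ 1) : ‖weightedShift σ c hc‖ ≤ 1 :=
  ContinuousLinearMap.opNorm_le_bound _ zero_le_one fun f => by
    rw [one_mul]
    exact (weightedShift_aux σ c hc f).2

theorem norm_a_le (i : ℤ) : ‖a i‖ ≤ 1 := by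
  change ‖annihilation i‖ ≤ 1
  exact norm_weightedShift_le _ _ fun T => by split_ifs <;> simp [norm_jwSign]

theorem norm_star_CAR (A : CAR) : ‖star A‖ = ‖A‖ := norm_star (A : Op)

theorem norm_localCharge_le (i : ℤ) : ‖localCharge i‖ ≤ 1 := by
  refine (norm_mul_le _ _).trans (mul_le_one₀ ((norm_mul_le _ _).trans (mul_le_one₀ (norm_a_le _)
    (norm_nonneg _) ?_)) (norm_nonneg _) (norm_a_le _))
  rw [norm_star_CAR]
  exact norm_a_le _

theorem star_localCharge_anticomm {i j : ℤ} (h : j ∉ Finset.Icc (i - 1) (i + 1)) :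
    star (localCharge i) * localCharge j + localCharge j * star (localCharge i) = 0 := by
  have hd : Disjoint (triple i) (triple j) := by
    rw [Finset.mem_Icc] at h
    rw [Finset.disjoint_left]
    intro k hk hk'
    simp only [triple, Finset.mem_insert, Finset.mem_singleton] at hk hk'
    omega
  rw [star_localCharge_mul_of_disjoint hd (localCharge_mem j), grading_localCharge]
  simp

/-- Linear rather than quadratic growth, since anticommutators of non-neighbouring charges vanish:
each `i` meets at most three `j`, each contributing norm at most `2`. -/
theorem norm_boxHam_le (n : ℕ) : ‖boxHam n‖ ≤ 6 * (2 * n + 1) := by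
  set J := Finset.Icc (-n : ℤ) n with hJ
  have e : boxHam n = ∑ i ∈ J, ∑ j ∈ J,
      (star (localCharge i) * localCharge j + localCharge j * star (localCharge i)) := by
    simp_rw [Finset.sum_add_distrib]
    rw [boxHam, boxCharge, charge, star_sum, Finset.sum_mul_sum, Finset.sum_mul_sum]
    exact congrArg _ Finset.sum_comm
  have hcard : (J.card : ℝ) = 2 * n + 1 := by
    have : J.card = 2 * n + 1 := by
      rw [hJ, Int.card_Icc]
      omega
    rw [this]
    push_cast
    ring
  have hin : ∀ i ∈ J, ‖∑ j ∈ J,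
      (star (localCharge i) * localCharge j + localCharge j * star (localCharge i))‖ ≤ 6 := by
    intro i _
    rw [← Finset.sum_filter_of_ne (p := fun j => j ∈ Finset.Icc (i - 1) (i + 1))
      fun j _ hne => by_contra fun hj => hne (star_localCharge_anticomm hj)]
    refine (norm_sum_le _ _).trans
      ((Finset.sum_le_sum (g := fun _ => (2 : ℝ)) fun j _ => ?_).trans ?_)
    · refine (norm_add_le _ _).trans ?_
      have hi := norm_localCharge_le i
      have hj := norm_localCharge_le j
      have h1 := norm_mul_le (star (localCharge i)) (localCharge j)
      have h2 := norm_mul_le (localCharge j) (star (localCharge i))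
      rw [norm_star_CAR] at h1 h2
      have h3 : ‖localCharge i‖ * ‖localCharge j‖ ≤ 1 := mul_le_one₀ hi (norm_nonneg _) hj
      linarith
    · rw [Finset.sum_const, nsmul_eq_mul]
      have : (J.filter fun j => j ∈ Finset.Icc (i - 1) (i + 1)).card ≤ 3 := by
        refine (Finset.card_le_card (t := Finset.Icc (i - 1) (i + 1)) fun j hj =>
          (Finset.mem_filter.1 hj).2).trans ?_
        rw [Int.card_Icc]
        omega
      have : ((J.filter fun j => j ∈ Finset.Icc (i - 1) (i + 1)).card : ℝ) ≤ 3 := by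
        exact_mod_cast this
      linarith
  rw [e]
  refine (norm_sum_le_of_le _ hin).trans ?_
  rw [Finset.sum_const, nsmul_eq_mul, hcard, mul_comm]

theorem isSelfAdjoint_boxHam (n : ℕ) : IsSelfAdjoint (boxHam n) := by
  rw [IsSelfAdjoint, boxHam, star_add, star_mul, star_mul, star_star]

/-! ### The time evolution -/

/-- The local algebra of `box (2 n)`, as a subspace of the CAR algebra. -/
def boxSpace (n : ℕ) : Submodule ℂ CAR where
  carrier := (fun A : CAR => (A : Op)) ⁻¹' (localAlgebra (box (2 * n)) : Set Op)
  zero_mem' := zero_mem (localAlgebra (box (2 * n)))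
  add_mem' := fun {A B} (h : (A : Op) ∈ localAlgebra (box (2 * n)))
    (h' : (B : Op) ∈ localAlgebra (box (2 * n))) => add_mem h h'
  smul_mem' := fun c A (h : (A : Op) ∈ localAlgebra (box (2 * n))) =>
    (localAlgebra (box (2 * n))).smul_mem h c

theorem mem_boxSpace {n : ℕ} {A : CAR} :
    A ∈ boxSpace n ↔ (A : Op) ∈ localAlgebra (box (2 * n)) := Iff.rfl

/-- The Hamiltonian that generates the dynamics on `boxSpace n`. -/
def evenBoxHam (n : ℕ) : selfAdjoint CAR := ⟨boxHam (2 * n + 2), isSelfAdjoint_boxHam _⟩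

theorem innerDer_evenBoxHam {n m : ℕ} (h : n ≤ m) {A : CAR} (hA : A ∈ boxSpace n) :
    InnerDynamics.innerDer (evenBoxHam m) A = Complex.I • hamDer A := by
  rw [InnerDynamics.innerDer_apply, hamDer_eq_box (m := 2 * m + 2) (by omega) (mem_boxSpace.1 hA)]
  rfl

theorem exists_isLocal_norm_sub_lt (A : CAR) {ε : ℝ} (hε : 0 < ε) :
    ∃ B : CAR, IsLocal B ∧ ‖A - B‖ < ε := by
  obtain ⟨B, hB, hAB⟩ := Metric.mem_closure_iff.1 A.2 ε hε
  obtain ⟨I, hI⟩ := mem_iSup_localAlgebra.1 hB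
  exact ⟨⟨B, mem_carAlgebra_of_mem_local hI⟩, ⟨I, hI⟩, by rwa [dist_eq_norm] at hAB⟩

theorem isLocal_iff_boxSpace {A : CAR} : IsLocal A ↔ ∃ n, A ∈ boxSpace n := by
  rw [isLocal_iff]
  exact ⟨fun ⟨n, hn⟩ => ⟨n, mem_boxSpace.2 (localAlgebra_mono (box_mono (by omega)) hn)⟩,
    fun ⟨n, hn⟩ => ⟨_, mem_boxSpace.1 hn⟩⟩

/-- `hamDer` enlarges a box by two, which the doubled index of `boxSpace` turns into one step. The
constant comes from `6 * (2 * (2n + 2) + 1) = 24n + 30 ≤ 30 (n + 1)`. -/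
theorem isFiniteRange : InnerDynamics.IsFiniteRange boxSpace evenBoxHam 30 where
  mono := fun _ _ h _ hA =>
    mem_boxSpace.2 (localAlgebra_mono (box_mono (by omega)) (mem_boxSpace.1 hA))
  dense := fun A ε hε => by
    obtain ⟨B, hB, hAB⟩ := exists_isLocal_norm_sub_lt A hε
    obtain ⟨n, hn⟩ := isLocal_iff_boxSpace.1 hB
    exact ⟨n, B, hn, hAB⟩
  innerDer_eq := fun h A hA => by rw [innerDer_evenBoxHam h hA, innerDer_evenBoxHam le_rfl hA]
  innerDer_mem := fun A hA => by
    rw [innerDer_evenBoxHam le_rfl hA]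
    exact Submodule.smul_mem _ _ (mem_boxSpace.2 (hamDer_mem (mem_boxSpace.1 hA)))
  pos := by norm_num
  norm_le := fun n => (norm_boxHam_le (2 * n + 2)).trans (by push_cast; linarith)

theorem exists_isTimeEvolution : ∃ α : ℝ → CAR ≃⋆ₐ[ℂ] CAR, IsTimeEvolution α := by
  obtain ⟨α, hadd, hcont, hgen⟩ := isFiniteRange.exists_dynamics
  refine ⟨α, hadd, hcont, hgen.trans (congrArg closure (Set.ext fun p => ?_))⟩
  simp only [Set.mem_ofPred_eq, isLocal_iff_boxSpace]
  constructor
  · rintro ⟨n, hn, hp⟩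
    exact ⟨⟨n, hn⟩, by rw [hp, innerDer_evenBoxHam le_rfl hn]⟩
  · rintro ⟨⟨n, hn⟩, hp⟩
    exact ⟨n, hn, by rw [hp, innerDer_evenBoxHam le_rfl hn]⟩

/-! ### Charges on occupation number vectors -/

theorem ket_apply (S T : Finset ℤ) : ket S T = if T = S then 1 else 0 := by
  by_cases h : T = S
  · subst h
    simp [ket]
  · simp [ket, lp.single_apply, h]

theorem annihilation_ket (i : ℤ) (S : Finset ℤ) :
    annihilation i (ket S) = (if i ∈ S then jwSign i S else 0) • ket (flip i S) := by
  ext T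
  by_cases h : T = flip i S
  · subst h
    have hi : i ∈ flip i S ↔ i ∉ S := by simp [mem_flip]
    by_cases h' : i ∈ S <;> simp [annihilation, ket_apply, flip_flip, hi, h', jwSign_flip]
  · have h' : flip i T ≠ S := fun e => h (by rw [← e, flip_flip])
    by_cases h'' : i ∈ S <;> simp [annihilation, ket_apply, h, h', h'']

theorem star_annihilation_ket (i : ℤ) (S : Finset ℤ) :
    star (annihilation i) (ket S) = (if i ∈ S then 0 else jwSign i S) • ket (flip i S) := by
  rw [star_annihilation]
  ext T
  by_cases h : T = flip i S
  · subst h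
    have hi : i ∈ flip i S ↔ i ∉ S := by simp [mem_flip]
    by_cases h' : i ∈ S <;> simp [ket_apply, flip_flip, hi, h', jwSign_flip]
  · have h' : flip i T ≠ S := fun e => h (by rw [← e, flip_flip])
    by_cases h'' : i ∈ S <;> simp [ket_apply, h, h', h'']

/-- Flipping the occupation of the three sites of `triple i`. -/
def tripleFlip (i : ℤ) (S : Finset ℤ) : Finset ℤ :=
  flip (2 * i + 1) (flip (2 * i) (flip (2 * i - 1) S))

/-- Distinct triples overlap only at odd sites, so the flipped even site identifies the triple. -/
theorem tripleFlip_injective {i j : ℤ} {S : Finset ℤ} (h : tripleFlip i S = tripleFlip j S) :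
    i = j := by
  by_contra hne
  have h1 : 2 * i ≠ 2 * i + 1 := by omega
  have h2 : 2 * i ≠ 2 * i - 1 := by omega
  have h3 : 2 * i ≠ 2 * j + 1 := by omega
  have h4 : 2 * i ≠ 2 * j - 1 := by omega
  have h5 : 2 * i ≠ 2 * j := by omega
  have hi : 2 * i ∈ tripleFlip i S ↔ 2 * i ∉ S := by
    simp only [tripleFlip, mem_flip, h1, h2]
    tauto
  have hj : 2 * i ∈ tripleFlip j S ↔ 2 * i ∈ S := by
    simp only [tripleFlip, mem_flip, h3, h4, h5]
    tauto
  rw [h, hj] at hi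
  tauto

/-- The scalar is a product of signs or zero; only whether it vanishes matters later. -/
theorem exists_localCharge_ket (i : ℤ) (S : Finset ℤ) :
    ∃ c : ℂ, (localCharge i : Op) (ket S) = c • ket (tripleFlip i S) ∧
      (c ≠ 0 ↔ 2 * i - 1 ∈ S ∧ 2 * i ∉ S ∧ 2 * i + 1 ∈ S) := by
  have e : (localCharge i : Op)
      = annihilation (2 * i + 1) * star (annihilation (2 * i)) * annihilation (2 * i - 1) := rfl
  have h1 : 2 * i ≠ 2 * i - 1 := by omega
  have h2 : 2 * i + 1 ≠ 2 * i := by omega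
  have h3 : 2 * i + 1 ≠ 2 * i - 1 := by omega
  have hj : ∀ k T, jwSign k T ≠ 0 := fun k T h => by simpa [h] using norm_jwSign k T
  rw [e, mul_apply_eq_comp, mul_apply_eq_comp, annihilation_ket, map_smul, star_annihilation_ket,
    map_smul, map_smul, annihilation_ket, smul_smul, smul_smul]
  refine ⟨_, rfl, ?_⟩
  simp [mem_flip, hj, h1, h2, h3]
  tauto

theorem exists_star_localCharge_ket (i : ℤ) (S : Finset ℤ) :
    ∃ c : ℂ, (star (localCharge i : Op)) (ket S) = c • ket (tripleFlip i S) ∧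
      (c ≠ 0 ↔ 2 * i - 1 ∉ S ∧ 2 * i ∈ S ∧ 2 * i + 1 ∉ S) := by
  have e : star (localCharge i : Op) = star (annihilation (2 * i - 1)) *
      (annihilation (2 * i) * star (annihilation (2 * i + 1))) := by
    change star (annihilation (2 * i + 1) * star (annihilation (2 * i))
      * annihilation (2 * i - 1)) = _
    simp only [star_mul, star_star]
  have h1 : 2 * i ≠ 2 * i + 1 := by omega
  have h2 : 2 * i - 1 ≠ 2 * i := by omega
  have h3 : 2 * i - 1 ≠ 2 * i + 1 := by omega
  have hj : ∀ k T, jwSign k T ≠ 0 := fun k T h => by simpa [h] using norm_jwSign k T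
  -- The adjoint acts in the opposite order, but flips commute, so the target vector is the same as
  -- for the charge.
  have hf : flip (2 * i - 1) (flip (2 * i) (flip (2 * i + 1) S)) = tripleFlip i S := by
    rw [tripleFlip, flip_comm (2 * i) (2 * i + 1), flip_comm (2 * i - 1) (2 * i + 1),
      flip_comm (2 * i - 1) (2 * i)]
  rw [e, mul_apply_eq_comp, mul_apply_eq_comp, star_annihilation_ket, map_smul, annihilation_ket,
    map_smul, map_smul, star_annihilation_ket, smul_smul, smul_smul, hf]
  refine ⟨_, rfl, ?_⟩
  simp [mem_flip, hj, h1, h2, h3]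

theorem inner_ket_ket {S T : Finset ℤ} (h : S ≠ T) : inner ℂ (ket S) (ket T) = 0 := by
  rw [inner_ket, ket_apply, if_neg h]

theorem inner_localCharge_ket {i j : ℤ} (h : i ≠ j) (S : Finset ℤ) :
    inner ℂ ((localCharge i : Op) (ket S)) ((localCharge j : Op) (ket S)) = 0 := by
  obtain ⟨c, hc, -⟩ := exists_localCharge_ket i S
  obtain ⟨d, hd, -⟩ := exists_localCharge_ket j S
  rw [hc, hd, inner_smul_left, inner_smul_right,
    inner_ket_ket fun e => h (tripleFlip_injective e), mul_zero, mul_zero]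

theorem inner_star_localCharge_ket {i j : ℤ} (h : i ≠ j) (S : Finset ℤ) :
    inner ℂ (star (localCharge i : Op) (ket S)) (star (localCharge j : Op) (ket S)) = 0 := by
  obtain ⟨c, hc, -⟩ := exists_star_localCharge_ket i S
  obtain ⟨d, hd, -⟩ := exists_star_localCharge_ket j S
  rw [hc, hd, inner_smul_left, inner_smul_right,
    inner_ket_ket fun e => h (tripleFlip_injective e), mul_zero, mul_zero]

theorem mem_occupied {g : ℤ → Fin 2} {Λ : Finset ℤ} {k : ℤ} (hk : k ∈ Λ) :
    k ∈ occupied g Λ ↔ g k = 1 := by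
  simp [occupied, hk]

theorem notMem_occupied {g : ℤ → Fin 2} {Λ : Finset ℤ} {k : ℤ} (hk : k ∈ Λ) :
    k ∉ occupied g Λ ↔ g k = 0 := by
  rw [mem_occupied hk]
  have := (g k).2
  simp only [Fin.ext_iff, Fin.val_one, Fin.val_zero]
  omega

/-- In a region that contains `triple i`, the charge `q_{2i}` and its adjoint both annihilate the
product vector if and only if `g` is not `0,1,0` or `1,0,1` on `triple i`. -/
theorem localCharge_ket_eq_zero_iff {g : ℤ → Fin 2} {Λ : Finset ℤ} {i : ℤ} (hi : triple i ⊆ Λ) :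
    ((localCharge i : Op) (ket (occupied g Λ)) = 0 ∧
      star (localCharge i : Op) (ket (occupied g Λ)) = 0) ↔
    ¬ (g (2 * i - 1) = 0 ∧ g (2 * i) = 1 ∧ g (2 * i + 1) = 0) ∧
      ¬ (g (2 * i - 1) = 1 ∧ g (2 * i) = 0 ∧ g (2 * i + 1) = 1) := by
  have h1 : 2 * i - 1 ∈ Λ := hi (by simp [triple])
  have h2 : 2 * i ∈ Λ := hi (by simp [triple])
  have h3 : 2 * i + 1 ∈ Λ := hi (by simp [triple])
  have hket : ∀ T, ket T ≠ 0 := fun T h => by simpa [h] using norm_ket T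
  obtain ⟨c, hc, hc'⟩ := exists_localCharge_ket i (occupied g Λ)
  obtain ⟨d, hd, hd'⟩ := exists_star_localCharge_ket i (occupied g Λ)
  rw [mem_occupied h1, notMem_occupied h2, mem_occupied h3] at hc'
  rw [notMem_occupied h1, mem_occupied h2, notMem_occupied h3] at hd'
  rw [hc, hd, smul_eq_zero_iff_left (hket _), smul_eq_zero_iff_left (hket _), ← hc', ← hd',
    not_not, not_not, and_comm]

theorem coe_boxCharge (n : ℕ) :
    (boxCharge n : Op) = ∑ i ∈ Finset.Icc (-n : ℤ) n, (localCharge i : Op) :=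
  map_sum carAlgebra.subtype localCharge _

theorem boxCharge_ket {g : ℤ → Fin 2} (hg : IsGroundConfig g) (n : ℕ) :
    (boxCharge n : Op) (ket (occupied g (box n))) = 0 ∧
      star (boxCharge n : Op) (ket (occupied g (box n))) = 0 := by
  have h := fun i (hi : i ∈ Finset.Icc (-n : ℤ) n) =>
    (localCharge_ket_eq_zero_iff (triple_subset_box hi)).2 (hg i)
  rw [coe_boxCharge, star_sum, sum_apply, sum_apply]
  exact ⟨Finset.sum_eq_zero fun i hi => (h i hi).1, Finset.sum_eq_zero fun i hi => (h i hi).2⟩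

/-! ### Supersymmetric classical states -/

theorem inner_star_left (A : Op) (x y : Fock) : inner ℂ (star A x) y = inner ℂ x (A y) :=
  ContinuousLinearMap.adjoint_inner_left A y x

theorem classicalState_of_mem_box (g : ℤ → Fin 2) {n m : ℕ} (h : n ≤ m) {A : CAR}
    (hA : (A : Op) ∈ localAlgebra (box n)) : classicalState g A
      = inner ℂ (ket (occupied g (box m))) ((A : Op) (ket (occupied g (box m)))) :=
  classicalState_of_mem_local g (localAlgebra_mono (box_mono h) hA)

/-- In `Q A - γ(A) Q` the second term dies because `Q` kills the vector, the first because `Q*`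
does. -/
theorem isSupersymmetric_of_isGroundConfig {g : ℤ → Fin 2} (hg : IsGroundConfig g) :
    IsSupersymmetric (classicalState g) := by
  refine ⟨isState_classicalState g, fun A hA => ?_⟩
  obtain ⟨n, hn⟩ := isLocal_iff.1 hA
  obtain ⟨h1, h2⟩ := boxCharge_ket hg (n + 1)
  rw [classicalState_of_mem_box g le_rfl (superDer_mem hn), superDer_eq_box le_rfl hn]
  change inner ℂ _ (((boxCharge (n + 1) : Op) * A - (grading A : Op) * boxCharge (n + 1)) _) = 0
  rw [sub_apply, mul_apply_eq_comp, mul_apply_eq_comp, h1, map_zero, sub_zero, ← inner_star_left,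
    h2, inner_zero_left]

theorem isGroundConfig_of_isSupersymmetric {g : ℤ → Fin 2}
    (h : IsSupersymmetric (classicalState g)) : IsGroundConfig g := by
  intro i
  obtain ⟨n, hn⟩ : ∃ n : ℕ, i ∈ Finset.Icc (-n : ℤ) n :=
    ⟨i.natAbs, by rw [Finset.mem_Icc]; omega⟩
  have hn' : i ∈ Finset.Icc (-(n + 1 : ℕ) : ℤ) (n + 1 : ℕ) := by
    rw [Finset.mem_Icc] at hn ⊢
    omega
  have hq : (star (localCharge i : CAR) : Op) ∈ localAlgebra (box n) :=
    star_mem (localAlgebra_mono (triple_subset_box hn) (localCharge_mem i))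
  -- The test observable is odd, so its superderivation is an anticommutator with the box charge,
  -- whose diagonal part is a sum of two squares.
  have h0 := h.2 (star (localCharge i)) ⟨_, hq⟩
  rw [classicalState_of_mem_box g le_rfl (superDer_mem hq), superDer_eq_box le_rfl hq,
    grading_star_localCharge, neg_mul, sub_neg_eq_add] at h0
  set v := ket (occupied g (box (n + 1))) with hv
  change inner ℂ v (((boxCharge (n + 1) : Op) * star (localCharge i : Op)
    + star (localCharge i : Op) * boxCharge (n + 1)) v) = 0 at h0
  -- Orthogonality of the images under different charges removes all terms except `i`.
  have e1 : inner ℂ v ((boxCharge (n + 1) : Op) (star (localCharge i : Op) v))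
      = (‖star (localCharge i : Op) v‖ : ℂ) ^ 2 := by
    rw [← inner_star_left, coe_boxCharge, star_sum, sum_apply, sum_inner,
      Finset.sum_eq_single_of_mem i hn' fun j _ hj => inner_star_localCharge_ket hj _]
    exact inner_self_eq_norm_sq_to_K _
  have e2 : inner ℂ v (star (localCharge i : Op) ((boxCharge (n + 1) : Op) v))
      = (‖(localCharge i : Op) v‖ : ℂ) ^ 2 := by
    rw [← inner_star_left, star_star, coe_boxCharge, sum_apply, inner_sum,
      Finset.sum_eq_single_of_mem i hn' fun j _ hj => inner_localCharge_ket hj.symm _]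
    exact inner_self_eq_norm_sq_to_K _
  rw [add_apply, mul_apply_eq_comp, mul_apply_eq_comp, inner_add_right, e1, e2] at h0
  have h1 : ‖star (localCharge i : Op) v‖ ^ 2 + ‖(localCharge i : Op) v‖ ^ 2 = 0 := by
    exact_mod_cast h0
  have h2 : ‖star (localCharge i : Op) v‖ = 0 := by nlinarith [norm_nonneg ((localCharge i : Op) v)]
  have h3 : ‖(localCharge i : Op) v‖ = 0 := by nlinarith
  exact (localCharge_ket_eq_zero_iff (triple_subset_box hn')).1
    ⟨norm_eq_zero.1 h3, norm_eq_zero.1 h2⟩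

/-! ### Ground states and invariance -/

theorem boxHam_ket {g : ℤ → Fin 2} (hg : IsGroundConfig g) (n : ℕ) :
    (boxHam n : Op) (ket (occupied g (box n))) = 0 := by
  obtain ⟨h1, h2⟩ := boxCharge_ket hg n
  change (star (boxCharge n : Op) * boxCharge n + boxCharge n * star (boxCharge n : Op)) _ = 0
  rw [add_apply, mul_apply_eq_comp, mul_apply_eq_comp, h1, h2, map_zero, map_zero, add_zero]

theorem classicalState_hamDer {g : ℤ → Fin 2} (hg : IsGroundConfig g) {A : CAR}
    (hA : IsLocal A) : classicalState g (hamDer A) = 0 := by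
  obtain ⟨n, hn⟩ := isLocal_iff.1 hA
  rw [classicalState_of_mem_box g le_rfl (hamDer_mem hn), hamDer_eq_box le_rfl hn]
  have hs : star (boxHam (n + 2) : Op) = boxHam (n + 2) :=
    congrArg Subtype.val (isSelfAdjoint_boxHam (n + 2))
  change inner ℂ _ (((boxHam (n + 2) : Op) * A - (A : Op) * boxHam (n + 2)) _) = 0
  rw [sub_apply, mul_apply_eq_comp, mul_apply_eq_comp, boxHam_ket hg, map_zero, sub_zero,
    ← inner_star_left, hs, boxHam_ket hg, inner_zero_left]

/-- As `H` kills the product vector `v`, the value is `⟨A v, H A v⟩ = ‖Q A v‖² + ‖Q* A v‖²`. -/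
theorem classicalState_star_mul_hamDer_nonneg {g : ℤ → Fin 2} (hg : IsGroundConfig g) {A : CAR}
    (hA : IsLocal A) : 0 ≤ classicalState g (star A * hamDer A) := by
  obtain ⟨n, hn⟩ := isLocal_iff.1 hA
  have hmem : ((star A * hamDer A : CAR) : Op) ∈ localAlgebra (box (n + 2)) :=
    mul_mem (star_mem (localAlgebra_mono (box_mono (by omega)) hn)) (hamDer_mem hn)
  rw [classicalState_of_mem_box g le_rfl hmem, hamDer_eq_box le_rfl hn]
  have hket := boxHam_ket hg (n + 2)
  have hpos : ∀ Q : Op, ∀ x : Fock,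
      inner ℂ x ((star Q * Q + Q * star Q) x) = ((‖Q x‖ ^ 2 + ‖star Q x‖ ^ 2 : ℝ) : ℂ) := by
    intro Q x
    have e1 : inner ℂ x (star Q (Q x)) = (‖Q x‖ : ℂ) ^ 2 := by
      rw [← inner_star_left, star_star]
      exact inner_self_eq_norm_sq_to_K _
    have e2 : inner ℂ x (Q (star Q x)) = (‖star Q x‖ : ℂ) ^ 2 := by
      rw [← inner_star_left]
      exact inner_self_eq_norm_sq_to_K _
    rw [add_apply, mul_apply_eq_comp, mul_apply_eq_comp, inner_add_right, e1, e2]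
    push_cast
    rfl
  change 0 ≤ inner ℂ _ ((star (A : Op) * ((boxHam (n + 2) : Op) * A - A * boxHam (n + 2))) _)
  rw [mul_apply_eq_comp, sub_apply, mul_apply_eq_comp, mul_apply_eq_comp, hket, map_zero,
    sub_zero, ← inner_star_left, star_star]
  have h := hpos (boxCharge (n + 2) : Op) ((A : Op) (ket (occupied g (box (n + 2)))))
  change inner ℂ _ ((boxHam (n + 2) : Op) _) = _ at h
  rw [h]
  exact Complex.zero_le_real.2 (add_nonneg (sq_nonneg _) (sq_nonneg _))

theorem norm_classicalState_le (g : ℤ → Fin 2) (A : CAR) : ‖classicalState g A‖ ≤ ‖A‖ :=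
  le_of_tendsto' (tendsto_classicalState g A).norm fun Λ => norm_expectation_le g Λ A

theorem continuous_classicalState (g : ℤ → Fin 2) : Continuous (classicalState g) :=
  AddMonoidHomClass.continuous_of_bound (classicalState g) 1 fun A => by
    rw [one_mul]
    exact norm_classicalState_le g A

theorem continuous_star_mul : Continuous fun p : CAR × CAR => star p.1 * p.2 := by
  have h1 : Continuous fun p : CAR × CAR => (p.1 : Op) := continuous_subtype_val.comp continuous_fst
  have h2 : Continuous fun p : CAR × CAR => (p.2 : Op) := continuous_subtype_val.comp continuous_snd
  have h3 : Continuous fun p : CAR × CAR => star (p.1 : Op) * (p.2 : Op) := h1.star.mul h2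
  exact h3.subtype_mk fun p => (star p.1 * p.2).2

/-- The inequality is a closed condition on pairs, so it extends from the core `i d` to the closure.
-/
theorem isGroundState_classicalState {α : ℝ → CAR ≃⋆ₐ[ℂ] CAR} (hα : IsTimeEvolution α)
    {g : ℤ → Fin 2} (hg : IsGroundConfig g) : IsGroundState α (classicalState g) := by
  refine ⟨isState_classicalState g, fun A B hAB => ?_⟩
  rw [hα.generator] at hAB
  have hcont : Continuous fun p : CAR × CAR => -Complex.I * classicalState g (star p.1 * p.2) :=
    ((continuous_classicalState g).comp continuous_star_mul).const_mul _
  have hclosed : IsClosed {p : CAR × CAR | 0 ≤ -Complex.I * classicalState g (star p.1 * p.2)} :=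
    isClosed_Ici.preimage hcont
  have hsub : {p : CAR × CAR | IsLocal p.1 ∧ p.2 = Complex.I • hamDer p.1}
      ⊆ {p : CAR × CAR | 0 ≤ -Complex.I * classicalState g (star p.1 * p.2)} := by
    intro p hp
    rw [Set.mem_ofPred_eq] at hp ⊢
    rw [hp.2, mul_smul_comm, map_smul, smul_eq_mul, ← mul_assoc, neg_mul, Complex.I_mul_I, neg_neg,
      one_mul]
    exact classicalState_star_mul_hamDer_nonneg hg hp.1
  have := closure_minimal hsub hclosed hAB
  rwa [Set.mem_ofPred_eq] at this

theorem classicalState_generator {α : ℝ → CAR ≃⋆ₐ[ℂ] CAR} (hα : IsTimeEvolution α)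
    {g : ℤ → Fin 2} (hg : IsGroundConfig g) {A B : CAR} (h : (A, B) ∈ generatorGraph α) :
    classicalState g B = 0 := by
  rw [hα.generator] at h
  have hclosed : IsClosed {p : CAR × CAR | classicalState g p.2 = 0} :=
    isClosed_eq ((continuous_classicalState g).comp continuous_snd) continuous_const
  have hsub : {p : CAR × CAR | IsLocal p.1 ∧ p.2 = Complex.I • hamDer p.1}
      ⊆ {p : CAR × CAR | classicalState g p.2 = 0} := by
    intro p hp
    rw [Set.mem_ofPred_eq] at hp ⊢
    rw [hp.2, map_smul, classicalState_hamDer hg hp.1, smul_zero]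
  have := closure_minimal hsub hclosed h
  rwa [Set.mem_ofPred_eq] at this

theorem isInvariant_classicalState {α : ℝ → CAR ≃⋆ₐ[ℂ] CAR} (hα : IsTimeEvolution α)
    {g : ℤ → Fin 2} (hg : IsGroundConfig g) : IsInvariant α (classicalState g) := by
  have h0 : ∀ A, α 0 A = A := fun A => by
    have := hα.map_add 0 0 A
    rw [add_zero] at this
    exact ((α 0).injective this).symm
  let ψ : CAR →L[ℂ] ℂ := ⟨classicalState g, continuous_classicalState g⟩
  have horbit : ∀ A B : CAR, (A, B) ∈ generatorGraph α → ∀ t,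
      HasDerivAt (fun s : ℝ => α s A) (α t B) t := fun A B hAB t =>
    InnerDynamics.hasDerivAt_orbit hα.map_add hAB t
  have hlocal : ∀ t A, IsLocal A → classicalState g (α t A) = classicalState g A := by
    intro t A hA
    have hgen : (A, Complex.I • hamDer A) ∈ generatorGraph α := by
      rw [hα.generator]
      exact subset_closure ⟨hA, rfl⟩
    have hd : ∀ s : ℝ, HasDerivAt (fun s : ℝ => ψ (α s A)) 0 s := fun s => by
      -- The domain is invariant and `α s` commutes with the generator. The derivative of the orbit
      -- is thus again a value of the generator, where the state vanishes.
      have hs : (α s A, α s (Complex.I • hamDer A)) ∈ generatorGraph α := by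
        rw [generatorGraph, Set.mem_ofPred_eq]
        have := horbit _ _ hgen s
        rw [← zero_add s] at this
        have := HasDerivAt.comp_add_const 0 s this
        simp_rw [hα.map_add] at this
        rwa [h0] at this
      have := (ψ.restrictScalars ℝ).hasFDerivAt.comp_hasDerivAt s (horbit _ _ hgen s)
      have hz : ψ (α s (Complex.I • hamDer A)) = 0 := classicalState_generator hα hg hs
      rw [← hz]
      exact this
    have := is_const_of_deriv_eq_zero (fun s => (hd s).differentiableAt) (fun s => (hd s).deriv) t 0
    rw [h0] at this
    exact this
  intro t A
  have hclosed : IsClosed {A : CAR | classicalState g (α t A) = classicalState g A} :=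
    isClosed_eq ((continuous_classicalState g).comp (StarAlgEquiv.isometry (α t)).continuous)
      (continuous_classicalState g)
  refine hclosed.closure_subset (Metric.mem_closure_iff.2 fun ε hε => ?_)
  obtain ⟨B, hB, hAB⟩ := exists_isLocal_norm_sub_lt A hε
  exact ⟨B, hlocal t B hB, by rwa [dist_eq_norm]⟩

end Nicolai

end

theorem theorem2 :
    (∀ g : ℤ → Fin 2,
      Nicolai.IsSupersymmetric (Nicolai.classicalState g) ↔ Nicolai.IsGroundConfig g) ∧
    (∃ α : ℝ → Nicolai.CAR ≃⋆ₐ[ℂ] Nicolai.CAR, Nicolai.IsTimeEvolution α) ∧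
    (∀ α : ℝ → Nicolai.CAR ≃⋆ₐ[ℂ] Nicolai.CAR, Nicolai.IsTimeEvolution α →
      ∀ g : ℤ → Fin 2, Nicolai.IsGroundConfig g →
        Nicolai.IsGroundState α (Nicolai.classicalState g) ∧
        Nicolai.IsInvariant α (Nicolai.classicalState g)) :=
  ⟨fun _ => ⟨Nicolai.isGroundConfig_of_isSupersymmetric,
      Nicolai.isSupersymmetric_of_isGroundConfig⟩,
    Nicolai.exists_isTimeEvolution,
    fun _ hα _ hg => ⟨Nicolai.isGroundState_classicalState hα hg,
      Nicolai.isInvariant_classicalState hα hg⟩⟩
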